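/- Let $\mathbb R^{2,1}$ be $\mathbb R^3$ with the Lorentzian inner product $B(x,y)=x_1y_1+x_2y_2-x_3y_3$. Let $S=S_{g,b}$ be a hyperbolic surface ($2g-2+b>0$) of genus $g$ with $b>0$ holes and no cusps, with Fuchsian group $G=G_{g,b}\subset \mathrm{SO}^o(2,1)$: a discrete group all of whose nontrivial elements are hyperbolic, identified with $$\pi_1(S_{g,b})=\langle \gamma_i,\ w_1^j,\ w_2^j \ (1\le i\le b,\ 1\le j\le g)\mid \gamma_1\cdots\gamma_b\,[w_1^1,w_2^1]\cdots[w_1^g,w_2^g]=1\rangle,\qquad [x,y]=xyx^{-1}y^{-1},$$ in such a way that $\gamma_1,\dots,\gamma_b$ are the holes of $S$. Put $c_i=\gamma_i$ for $i\le b$ and $c_{b+j}=[w_1^j,w_2^j]$. If $g+b\ge 3$, the dividing curves $g^j=[w_1^j,w_2^j]$ $(1\le j\le g)$ and $f_k=(c_1\cdots c_{k+1})^{-1}$ $(1\le k\le g+b-3)$ decompose $S$ into $g$ once-holed tori $\langle w_1^j,w_2^j\rangle$ and $g+b-2$ pairs of pants; if $g=b=1$, then $S$ is itself a once-holed torus and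 there are no dividing curves. For a hyperbolic $h\in \mathrm{SO}^o(2,1)$ let $X_h^-,X_h^+$ be the future-pointing null eigenvectors of Euclidean norm $1$ for its smallest and largest eigenvalue, and let $X_h^0$ be the unit spacelike fixed vector of $h$ with $\det(X_h^0,X_h^-,X_h^+)>0$. A cocycle is a map $u:G\to\mathbb R^{2,1}$ with $u(h_1h_2)=h_1u(h_2)+u(h_1)$, a coboundary is a cocycle $h\mapsto v-hv$ with $v\in\mathbb R^{2,1}$, and $H^1(G,\mathbb R^{2,1})$ is the space of cocycles modulo coboundaries. The Margulis invariant of $u$ at $h$ is $\mathrm{Mar}_u(h)=B(u(h),X_h^0)$. A dividing curve $c$ separates $S$ into two subsurfaces with fundamental groups $Q_1,Q_2\subset G$: for $c=g^j$, $Q_2=\langle w_1^j,w_2^j\rangle$ and $Q_1$ is generated by the other generators; for $c=f_k$, $Q_1$ is generated by the generators that occur in $c_1,\dots,c_{k+1}$ and $Q_2$ by the others. Assume that for each $j$ the angle in $(0,\pi)$ at which the axes of $w_1^j$ and $w_2^j$ cross in the hyperbolic plane is not $\pi/2$. Then: (a) $\dim H^1(G,\mathbb R^{2,1})=6g+3b-6$.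 (b) For each dividing curve $c$ there is exactly one cocycle $\mathrm{AT}_c$ (the affine twist cocycle along $c$) that vanishes on $Q_1$ and satisfies $\mathrm{AT}_c(h)=X_c^0-hX_c^0$ for all $h\in Q_2$. (c) Let $\mathcal C$ be the collection of the holes $\gamma_i$, the dividing curves, and all $w_1^j,w_2^j$. There is a linear family of reference cocycles, that is, a linear map $m\mapsto\sigma(m)$ from $\mathbb R^{\mathcal C}$ to the space of cocycles with $\mathrm{Mar}_{\sigma(m)}(x)=m_x$ for all $m$ and all $x\in\mathcal C$. (d) Fix any such $\sigma$. For every cocycle $u$ there are unique real numbers $\tau_c$, one for each dividing curve $c$ (the affine twist parameters of $u$ relative to $\sigma$), such that $$[u]=\big[\sigma\big((\mathrm{Mar}_u(x))_{x\in\mathcal C}\big)\big]+\sum_{c}\tau_c\,[\mathrm{AT}_c]$$ in $H^1(G,\mathbb R^{2,1})$, and the Margulis invariants and affine twist parameters are linear coordinates: the map $[u]\mapsto\big((\mathrm{Mar}_u(x))_{x\in\mathcal C},(\tau_c)_c\big)$ is a well-defined linear isomorphism of $H^1(G,\mathbb R^{2,1})$ onto the space of all real vectors indexed by $\mathcal C$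 and the dividing curves. -/

import Mathlib

open scoped Matrix

/-! ## Lorentzian linear algebra -/

/-- The Lorentzian inner product `x₁y₁ + x₂y₂ - x₃y₃` on `ℝ³`. -/
def lorentz (x y : Fin 3 → ℝ) : ℝ := x 0 * y 0 + x 1 * y 1 - x 2 * y 2

/-- The group `SO°(2,1)`, as a subset of `GL₃(ℝ)`: the linear maps that preserve the Lorentzian
inner product, the orientation and the time orientation. -/
def SO21 : Set (GL (Fin 3) ℝ) :=
  {A | (∀ x y : Fin 3 → ℝ, lorentz (A.1 *ᵥ x) (A.1 *ᵥ y) = lorentz x y) ∧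
    A.1.det = 1 ∧ 0 < A.1 2 2}

/-- `A` is hyperbolic: it has three distinct real eigenvalues. -/
def IsHyperbolic (A : GL (Fin 3) ℝ) : Prop :=
  ∃ a b c : ℝ, a < b ∧ b < c ∧
    Module.End.HasEigenvalue (Matrix.toLin' A.1) a ∧
    Module.End.HasEigenvalue (Matrix.toLin' A.1) b ∧
    Module.End.HasEigenvalue (Matrix.toLin' A.1) c

/-- A future-pointing null vector of Euclidean norm one. -/
def IsUnitFutureNull (x : Fin 3 → ℝ) : Prop :=
  lorentz x x = 0 ∧ 0 < x 2 ∧ x ⬝ᵥ x = 1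

/-- `(X⁰, X⁻, X⁺)` is the null frame of the hyperbolic element `A` of `SO°(2,1)`: `X⁻` and `X⁺` are
the normalized future-pointing null eigenvectors for the smallest and the largest eigenvalue
`r < 1 < r⁻¹`, and `X⁰` is the unit spacelike vector fixed by `A` with `det (X⁰, X⁻, X⁺) > 0`. -/
def IsNullFrame (A : GL (Fin 3) ℝ) (X0 Xm Xp : Fin 3 → ℝ) : Prop :=
  (∃ r : ℝ, 0 < r ∧ r < 1 ∧ A.1 *ᵥ Xm = r • Xm ∧ A.1 *ᵥ Xp = r⁻¹ • Xp) ∧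
  IsUnitFutureNull Xm ∧ IsUnitFutureNull Xp ∧
  A.1 *ᵥ X0 = X0 ∧ lorentz X0 X0 = 1 ∧ 0 < (Matrix.of ![X0, Xm, Xp]).det

/-- The vector `X⁰` of the null frame of a hyperbolic element. -/
noncomputable def neutralVector (A : GL (Fin 3) ℝ) : Fin 3 → ℝ :=
  Classical.epsilon fun X0 => ∃ Xm Xp, IsNullFrame A X0 Xm Xp

/-- The vector `X⁺` of the null frame of a hyperbolic element; it spans the null ray that is the
attracting fixed point at infinity. -/
noncomputable def attractingVector (A : GL (Fin 3) ℝ) : Fin 3 → ℝ :=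
  Classical.epsilon fun Xp => ∃ X0 Xm, IsNullFrame A X0 Xm Xp

/-! ## Angles in the hyperbolic plane

The hyperbolic plane is the sheet `{p | B(p,p) = -1, p₃ > 0}`; the invariant axis of a hyperbolic
element `A` is its intersection with the plane `(X⁰)^⊥`. -/

/-- `p` is a point of the hyperbolic plane on the invariant axis of `A`. -/
def OnAxis (A : GL (Fin 3) ℝ) (p : Fin 3 → ℝ) : Prop :=
  lorentz p p = -1 ∧ 0 < p 2 ∧ lorentz p (neutralVector A) = 0

/-- `t` is a unit tangent vector at `p` of the invariant axis of `A`. -/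
def IsAxisTangent (A : GL (Fin 3) ℝ) (p t : Fin 3 → ℝ) : Prop :=
  lorentz t p = 0 ∧ lorentz t t = 1 ∧ lorentz t (neutralVector A) = 0

/-- `θ ∈ (0, π)` is the angle from the invariant axis of `A` to the invariant axis of `B` at a
point `p` where they cross: the angle between the unit tangent `t` of the axis of `A`, directed
towards the attracting fixed point of `A`, and that unit tangent `d` of the (unoriented) axis of
`B` which points to the left of `t`. -/
def IsAxisAngle (A B : GL (Fin 3) ℝ) (θ : ℝ) : Prop :=
  ∃ p t d : Fin 3 → ℝ, OnAxis A p ∧ OnAxis B p ∧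
    IsAxisTangent A p t ∧ 0 < lorentz t (attractingVector A) ∧
    IsAxisTangent B p d ∧ 0 < (Matrix.of ![t, d, p]).det ∧
    0 < θ ∧ θ < Real.pi ∧ Real.cos θ = lorentz t d

/-! ## Hyperbolic surfaces with holes and their decomposition -/

/-- Generators of the fundamental group of the surface of genus `g` with `b` boundary components:
the boundary loops, and a longitude and a meridian of each handle. -/
inductive SurfaceGen (g b : ℕ) : Type
  | bdry (i : Fin b)
  | lon (j : Fin g)
  | mer (j : Fin g)

/-- The loops `γ₁, …, γ_b, [w₁¹, w₂¹], …, [w₁ᵍ, w₂ᵍ]` with `[x, y] = x y x⁻¹ y⁻¹`, which bound the `(g+b)`-holed sphere that is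
left when the `g` once-holed tori are cut off. -/
def planarLoops (g b : ℕ) : List (FreeGroup (SurfaceGen g b)) :=
  List.ofFn (fun i : Fin b => FreeGroup.of (SurfaceGen.bdry i)) ++
  List.ofFn (fun j : Fin g =>
    FreeGroup.of (SurfaceGen.lon j) * FreeGroup.of (SurfaceGen.mer j) *
      (FreeGroup.of (SurfaceGen.lon j))⁻¹ * (FreeGroup.of (SurfaceGen.mer j))⁻¹)

/-- The fundamental group of the surface of genus `g` with `b` boundary components:
`⟨γᵢ, w₁ʲ, w₂ʲ | γ₁ ⋯ γ_b [w₁¹, w₂¹] ⋯ [w₁ᵍ, w₂ᵍ] = 1⟩`. -/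
abbrev SurfaceGroup (g b : ℕ) : Type :=
  PresentedGroup ({(planarLoops g b).prod} : Set (FreeGroup (SurfaceGen g b)))

/-- The subgroup `G` of `SO°(2,1)` lies on one side of the axis of `h ∈ G`, that is, no limit point
of `G` lies strictly on the other side. For a Fuchsian group with only hyperbolic elements this
says that the axis of `h` covers a boundary component of the convex core of the quotient
surface, i.e. that `h` is freely homotopic to a power of a hole. -/
def IsPeripheral (G : Subgroup (GL (Fin 3) ℝ)) (h : GL (Fin 3) ℝ) : Prop :=
  h ∈ G ∧ h ≠ 1 ∧
    ((∀ k ∈ G, k ≠ 1 → 0 ≤ lorentz (neutralVector h) (attractingVector k)) ∨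
     (∀ k ∈ G, k ≠ 1 → lorentz (neutralVector h) (attractingVector k) ≤ 0))

/-- A hyperbolic surface of genus `g` with `b` holes and no cusps, given by its Fuchsian group
together with a standard system of generators: `G` is a discrete subgroup of `SO°(2,1)` with
only hyperbolic nontrivial elements, identified with the fundamental group of the surface of
type `(g, b)` in such a way that the loops `γ₁, …, γ_b` are exactly the holes. -/
structure HyperbolicSurface (g b : ℕ) where
  /-- the Fuchsian group -/
  G : Subgroup (GL (Fin 3) ℝ)
  subset_SO21 : (G : Set (GL (Fin 3) ℝ)) ⊆ SO21
  discrete : DiscreteTopology G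
  hyperbolic : ∀ h ∈ G, h ≠ 1 → IsHyperbolic h
  /-- the identification with the fundamental group of the topological surface -/
  marking : SurfaceGroup g b ≃* G
  peripheral_bdry : ∀ i : Fin b,
    IsPeripheral G (marking (PresentedGroup.of (SurfaceGen.bdry i))).1
  eq_bdry_of_peripheral : ∀ h : G, IsPeripheral G h.1 →
    ∃ (i : Fin b) (k : G) (m : ℤ),
      h = k * marking (PresentedGroup.of (SurfaceGen.bdry i)) ^ m * k⁻¹

/-- The dividing curves of the decomposition into `g` once-holed tori and `g+b-2` pairs of pants:
the boundary curves of the `g` once-holed tori, and the `g+b-3` curves that cut the `(g+b)`-holed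
sphere into pairs of pants. For `g = b = 1` the surface is itself a once-holed torus, whose
boundary curve is a hole and not a dividing curve. -/
inductive DividingCurve (g b : ℕ) : Type
  | handle (j : Fin g) (h : 3 ≤ g + b)
  | planar (k : Fin (g + b - 3))

noncomputable instance (g b : ℕ) : Fintype (DividingCurve g b) :=
  Fintype.ofInjective
    (fun c => match c with
      | .handle j _ => (Sum.inl j : Fin g ⊕ Fin (g + b - 3))
      | .planar k => Sum.inr k)
    (by rintro (⟨j, h⟩ | k) (⟨j', h'⟩ | k') e <;> simp_all)

/-- The curves whose Margulis invariants are coordinates: the holes, the dividing curves, and the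
longitude and the meridian of each once-holed torus. -/
inductive CoordCurve (g b : ℕ) : Type
  | bdry (i : Fin b)
  | div (c : DividingCurve g b)
  | lon (j : Fin g)
  | mer (j : Fin g)

/-- The position, among the loops bounding the `(g+b)`-holed sphere, of the hole or handle to
which a generator belongs. -/
def SurfaceGen.pos {g b : ℕ} : SurfaceGen g b → ℕ
  | .bdry i => i
  | .lon j => b + j
  | .mer j => b + j

/-- A dividing curve separates the surface in two; this selects the generators on the second
side. For the boundary curve of a once-holed torus the second side is that torus; the `k`-th
planar curve (`k = 0, 1, …`) has the first `k + 2` holes and handles on its first side. -/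
def DividingCurve.OnSecondSide {g b : ℕ} :
    DividingCurve g b → SurfaceGen g b → Prop
  | .handle j _, x => x.pos = b + j
  | .planar k, x => (k : ℕ) + 2 ≤ x.pos

namespace HyperbolicSurface

variable {g b : ℕ} (S : HyperbolicSurface g b)

/-- The element of the Fuchsian group represented by a word in the generators. -/
def elt (w : FreeGroup (SurfaceGen g b)) : S.G := S.marking (PresentedGroup.mk _ w)

/-- The longitude of the `j`-th once-holed torus. -/
def lon (j : Fin g) : S.G := S.elt (FreeGroup.of (.lon j))

/-- The meridian of the `j`-th once-holed torus. -/
def mer (j : Fin g) : S.G := S.elt (FreeGroup.of (.mer j))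

/-- The element of a dividing curve: `[w₁ʲ, w₂ʲ]` for the boundary of the `j`-th once-holed torus,
and the inverse of the product of the first `k + 2` planar loops for the `k`-th planar curve
(`k = 0, 1, …`). -/
def div : DividingCurve g b → S.G
  | .handle j _ => S.lon j * S.mer j * (S.lon j)⁻¹ * (S.mer j)⁻¹
  | .planar k => (S.elt ((planarLoops g b).take (k + 2)).prod)⁻¹

/-- The element of a coordinate curve. -/
def curve : CoordCurve g b → S.G
  | .bdry i => S.elt (FreeGroup.of (.bdry i))
  | .div c => S.div c
  | .lon j => S.lon j
  | .mer j => S.mer j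

/-- The fundamental group of the first of the two subsurfaces separated by a dividing curve. -/
def firstSide (c : DividingCurve g b) : Subgroup S.G :=
  Subgroup.closure {h | ∃ x : SurfaceGen g b, ¬ c.OnSecondSide x ∧ h = S.elt (FreeGroup.of x)}

/-- The fundamental group of the second of the two subsurfaces separated by a dividing curve. -/
def secondSide (c : DividingCurve g b) : Subgroup S.G :=
  Subgroup.closure {h | ∃ x : SurfaceGen g b, c.OnSecondSide x ∧ h = S.elt (FreeGroup.of x)}

/-! ## Affine deformations -/

/-- The linear action of the Fuchsian group on `ℝ³`. -/
noncomputable def rep : Rep ℝ S.G :=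
  Rep.of (X := Fin 3 → ℝ)
    ((Matrix.toLinAlgEquiv' (R := ℝ) (n := Fin 3)).toMulEquiv.toMonoidHom.comp
      ((Units.coeHom _).comp S.G.subtype))

/-- The space of cocycles, `u (h₁ h₂) = h₁ u(h₂) + u(h₁)`. -/
abbrev Z1 : Type := groupCohomology.cocycles₁ S.rep

/-- The value of a cocycle, as a vector of `ℝ³`. -/
def val (u : S.Z1) (h : S.G) : Fin 3 → ℝ := u.1 h

/-- The space of affine deformations: cocycles modulo coboundaries. -/
noncomputable abbrev H1 : Type := groupCohomology.H1 S.rep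

/-- The cohomology class of a cocycle. -/
noncomputable def cls : S.Z1 →ₗ[ℝ] S.H1 := (groupCohomology.H1π S.rep).hom

/-- The Margulis invariant of `h` for the affine deformation with translation part `u`: the signed
Lorentzian displacement `B(η(x) - x, X⁰)` of `η = (h, u(h))`, taken at `x = 0`. -/
noncomputable def Mar (u : S.Z1) (h : S.G) : ℝ := lorentz (S.val u h) (neutralVector h.1)

/-- `u` is the affine twist cocycle along the dividing curve `c`: it vanishes on the first side and
is the coboundary `h ↦ X⁰ - h X⁰` of the neutral vector `X⁰` of `c` on the second side. -/
def IsAffineTwist (c : DividingCurve g b) (u : S.Z1) : Prop :=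
  (∀ h ∈ S.firstSide c, S.val u h = 0) ∧
  (∀ h ∈ S.secondSide c,
    S.val u h = neutralVector (S.div c).1 - h.1.1 *ᵥ neutralVector (S.div c).1)

/-- A linear system of reference cocycles (the normalization from which affine twists are
measured): for each prescription `m` of the Margulis invariants of the coordinate curves a
cocycle with these invariants, depending linearly on `m`. -/
def IsReference (σ : (CoordCurve g b → ℝ) →ₗ[ℝ] S.Z1) : Prop :=
  ∀ m x, S.Mar (σ m) (S.curve x) = m x

/-- `τ` is the family of affine twist parameters of `u` along the dividing curves, relative to the
reference `σ`: up to a coboundary, `u` is the reference cocycle with the same Margulis invariants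
plus `∑ τ_c AT_c`, where `AT_c` is the affine twist cocycle along `c`. -/
def HasTwistParameters (σ : (CoordCurve g b → ℝ) →ₗ[ℝ] S.Z1) (u : S.Z1)
    (τ : DividingCurve g b → ℝ) : Prop :=
  ∃ AT : DividingCurve g b → S.Z1, (∀ c, S.IsAffineTwist c (AT c)) ∧
    S.cls u = S.cls (σ fun x => S.Mar u (S.curve x)) + ∑ c, τ c • S.cls (AT c)

end HyperbolicSurface

/-! ### Linear algebra of the Lorentzian form on `ℝ³`. -/

section LorentzianAlgebra

/-! As `b > 0`, the surface relation solves for the first boundary loop, so `G` is free on the other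
`2g+b-1` generators and cocycles take arbitrary values there: `dim Z¹ = 3(2g+b-1)`. Noncommuting
elements share no nonzero fixed vector, so the coboundaries form a copy of `ℝ³`. This gives (a).
Freeness also supplies homomorphisms to small permutation groups that show the required pairs of
curves do not commute.

The core is `exists_eq_coboundary_add_sum`: a cocycle `u` whose Margulis invariants vanish on all
coordinate curves is a coboundary plus a combination of affine twists. Vanishing at `h ≠ 1` means
that `u` agrees at `h` with the coboundary of some vector, unique up to multiples of `X_h⁰`. On a
pair of pants the vectors belonging to the boundary curves can be replaced by a single one
(`exists_common_of_pants`); on a once-holed torus the same holds unless the axes of the generators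
are orthogonal (`exists_common_of_torus`). In both cases the condition at the remaining boundary
curve is one linear equation, and it says exactly that two affine lines meet. Two adjacent pieces
share a dividing curve `c`, so their vectors differ by a multiple of `X_c⁰`, and this jump is what
`AT_c` produces.

The rest is counting. Let `D` be the number of dividing curves; then `|C| + D = 6g+3b-6`. The kernel
of the Margulis map has dimension at most `3 + D`, which forces that map to be onto and gives the
reference family. Margulis invariants and twist parameters then parametrize all of `H¹` by a space
of the same dimension, so the parametrization is an isomorphism. Neither the independence of the
twist classes nor their Margulis invariants have to be computed. -/

theorem lorentz_comm (x y : Fin 3 → ℝ) : lorentz x y = lorentz y x := by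
  simp only [lorentz]; ring

theorem lorentz_add_left (x y z : Fin 3 → ℝ) :
    lorentz (x + y) z = lorentz x z + lorentz y z := by
  simp only [lorentz, Pi.add_apply]; ring

theorem lorentz_sub_left (x y z : Fin 3 → ℝ) :
    lorentz (x - y) z = lorentz x z - lorentz y z := by
  simp only [lorentz, Pi.sub_apply]; ring

theorem lorentz_smul_left (a : ℝ) (x z : Fin 3 → ℝ) :
    lorentz (a • x) z = a * lorentz x z := by
  simp only [lorentz, Pi.smul_apply, smul_eq_mul]; ring

theorem lorentz_add_right (x y z : Fin 3 → ℝ) :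
    lorentz z (x + y) = lorentz z x + lorentz z y := by
  simp only [lorentz, Pi.add_apply]; ring

theorem lorentz_sub_right (x y z : Fin 3 → ℝ) :
    lorentz z (x - y) = lorentz z x - lorentz z y := by
  simp only [lorentz, Pi.sub_apply]; ring

theorem lorentz_smul_right (a : ℝ) (x z : Fin 3 → ℝ) :
    lorentz z (a • x) = a * lorentz z x := by
  simp only [lorentz, Pi.smul_apply, smul_eq_mul]; ring

theorem lorentz_zero_left (z : Fin 3 → ℝ) : lorentz 0 z = 0 := by simp [lorentz]

theorem eq_zero_of_lorentz_eq_zero {x : Fin 3 → ℝ} (h : ∀ y, lorentz x y = 0) : x = 0 := by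
  ext i
  have := h (Pi.single i 1)
  fin_cases i <;> simpa [lorentz] using this

/-- Three vectors with nonzero determinant span `ℝ³`. -/
theorem exists_coordinates {x y z : Fin 3 → ℝ} (h : (Matrix.of ![x, y, z]).det ≠ 0)
    (v : Fin 3 → ℝ) : ∃ α β γ : ℝ, v = α • x + β • y + γ • z := by
  set M := Matrix.of ![x, y, z]
  have hv : (v ᵥ* M⁻¹) ᵥ* M = v := by
    rw [Matrix.vecMul_vecMul, Matrix.nonsing_inv_mul _ (isUnit_iff_ne_zero.2 h), Matrix.vecMul_one]
  refine ⟨(v ᵥ* M⁻¹) 0, (v ᵥ* M⁻¹) 1, (v ᵥ* M⁻¹) 2, ?_⟩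
  rw [Matrix.vecMul_eq_sum, Fin.sum_univ_three] at hv
  exact hv.symm

/-- The Lorentzian orthogonal complement of a nonzero vector is spanned by any two independent
vectors in it. -/
theorem exists_eq_add_smul_of_orthogonal {n x y w : Fin 3 → ℝ} (hn : n ≠ 0)
    (hxy : ∀ α β : ℝ, α • x + β • y = 0 → α = 0 ∧ β = 0)
    (hx : lorentz x n = 0) (hy : lorentz y n = 0) (hw : lorentz w n = 0) :
    ∃ α β : ℝ, w = α • x + β • y := by
  by_cases h : (Matrix.of ![x, y, w]).det = 0
  · obtain ⟨v, hv, hv0⟩ := Matrix.exists_vecMul_eq_zero_iff.2 h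
    rw [Matrix.vecMul_eq_sum, Fin.sum_univ_three] at hv0
    have e : v 0 • x + v 1 • y + v 2 • w = 0 := hv0
    have h2 : v 2 ≠ 0 := by
      intro h2
      rw [h2, zero_smul, add_zero] at e
      obtain ⟨h0, h1⟩ := hxy _ _ e
      exact hv (by ext i; fin_cases i <;> assumption)
    refine ⟨-(v 0 / v 2), -(v 1 / v 2), ?_⟩
    ext i
    have := congrFun e i
    simp only [Pi.add_apply, Pi.smul_apply, smul_eq_mul, Pi.zero_apply] at this ⊢
    field_simp
    linarith
  -- If the three vectors spanned `ℝ³`, then `n` would be orthogonal to everything.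
  · refine (hn ?_).elim
    apply eq_zero_of_lorentz_eq_zero
    intro v
    obtain ⟨α, β, γ, rfl⟩ := exists_coordinates h v
    rw [lorentz_comm, lorentz_add_left, lorentz_add_left, lorentz_smul_left, lorentz_smul_left,
      lorentz_smul_left, hx, hy, hw]
    ring

theorem det_smul_first (a : ℝ) (x y z : Fin 3 → ℝ) :
    (Matrix.of ![a • x, y, z]).det = a * (Matrix.of ![x, y, z]).det := by
  simp [Matrix.det_fin_three]; ring

theorem det_smul_second (a : ℝ) (x y z : Fin 3 → ℝ) :
    (Matrix.of ![x, a • y, z]).det = a * (Matrix.of ![x, y, z]).det := by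
  simp [Matrix.det_fin_three]; ring

theorem det_smul_third (a : ℝ) (x y z : Fin 3 → ℝ) :
    (Matrix.of ![x, y, a • z]).det = a * (Matrix.of ![x, y, z]).det := by
  simp [Matrix.det_fin_three]; ring

theorem det_swap_second_third (x y z : Fin 3 → ℝ) :
    (Matrix.of ![x, z, y]).det = - (Matrix.of ![x, y, z]).det := by
  simp [Matrix.det_fin_three]; ring

theorem det_rotate (x y z : Fin 3 → ℝ) :
    (Matrix.of ![y, z, x]).det = (Matrix.of ![x, y, z]).det := by
  simp [Matrix.det_fin_three]; ring

/-- Every nonzero null vector has a multiple that is future-pointing of Euclidean norm one. -/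
theorem exists_smul_isUnitFutureNull {y : Fin 3 → ℝ} (hy : y ≠ 0) (hn : lorentz y y = 0) :
    ∃ a : ℝ, a ≠ 0 ∧ IsUnitFutureNull (a • y) := by
  simp only [lorentz] at hn
  have h2 : y 2 ≠ 0 := by
    intro h2
    rw [h2] at hn
    refine hy (funext fun i => ?_)
    fin_cases i
    · show y 0 = 0
      nlinarith [mul_self_nonneg (y 0), mul_self_nonneg (y 1)]
    · show y 1 = 0
      nlinarith [mul_self_nonneg (y 0), mul_self_nonneg (y 1)]
    · exact h2
  have hs : Real.sqrt 2 * Real.sqrt 2 = 2 := Real.mul_self_sqrt (by norm_num)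
  have hs0 : 0 < Real.sqrt 2 := by positivity
  -- A null vector has squared Euclidean norm `2 (y 2)²`.
  refine ⟨(Real.sqrt 2 * y 2)⁻¹, by positivity, ?_, ?_, ?_⟩
  · rw [lorentz_smul_left, lorentz_smul_right]
    simp only [lorentz, hn, mul_zero]
  · rw [Pi.smul_apply, smul_eq_mul, mul_inv, mul_assoc, inv_mul_cancel₀ h2]
    positivity
  · simp only [dotProduct, Fin.sum_univ_three, Pi.smul_apply, smul_eq_mul]
    field_simp
    nlinarith

/-- A null vector pairing negatively with a future-pointing
timelike vector is future-pointing. -/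
theorem pos_of_lorentz_neg {t z : Fin 3 → ℝ} (ht : lorentz t t < 0) (ht2 : 0 < t 2)
    (hz : lorentz z z = 0) (hzt : lorentz z t < 0) : 0 < z 2 := by
  simp only [lorentz] at *
  by_contra! h
  have h1 : (z 0 * t 0 + z 1 * t 1) ^ 2 ≤ (z 2 * t 2) ^ 2 := by
    have : (z 2 * t 2) ^ 2 = (z 0 * z 0 + z 1 * z 1) * (t 2 * t 2) := by
      rw [show z 0 * z 0 + z 1 * z 1 = z 2 * z 2 by linarith]; ring
    rw [this]
    nlinarith [sq_nonneg (z 0 * t 1 - z 1 * t 0),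
      mul_nonneg (add_nonneg (mul_self_nonneg (z 0)) (mul_self_nonneg (z 1)))
        (show 0 ≤ t 2 * t 2 - (t 0 * t 0 + t 1 * t 1) by linarith)]
  have h2 : 0 ≤ -(z 2 * t 2) := by nlinarith
  have := abs_le_of_sq_le_sq' (by simpa using h1 : _ ≤ (-(z 2 * t 2)) ^ 2) h2
  linarith [this.1]

/-- A vector orthogonal to a nonzero null vector is not timelike. -/
theorem lorentz_self_nonneg_of_orthogonal {x y : Fin 3 → ℝ} (hy : IsUnitFutureNull y)
    (hxy : lorentz x y = 0) : 0 ≤ lorentz x x := by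
  obtain ⟨hn, h2, -⟩ := hy
  simp only [lorentz] at *
  have e : x 0 * y 0 + x 1 * y 1 = x 2 * y 2 := by linarith
  have h : (x 2 * y 2) ^ 2 ≤ (x 0 * x 0 + x 1 * x 1) * (y 2 * y 2) := by
    rw [← e, show y 2 * y 2 = y 0 * y 0 + y 1 * y 1 by linarith]
    nlinarith [sq_nonneg (x 0 * y 1 - x 1 * y 0)]
  have h3 : 0 < y 2 * y 2 := by positivity
  by_contra! h4
  nlinarith

/-- Two orthogonal unit spacelike vectors are the poles of geodesics that cross at a right angle. -/
theorem exists_orthogonal_crossing {x y a : Fin 3 → ℝ} (hxx : lorentz x x = 1)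
    (hyy : lorentz y y = 1) (hxy : lorentz x y = 0) (hya : lorentz y a ≠ 0) :
    ∃ p t d : Fin 3 → ℝ, lorentz p p = -1 ∧ 0 < p 2 ∧ lorentz p x = 0 ∧ lorentz p y = 0 ∧
      lorentz t p = 0 ∧ lorentz t t = 1 ∧ lorentz t x = 0 ∧ 0 < lorentz t a ∧
      lorentz d p = 0 ∧ lorentz d d = 1 ∧ lorentz d y = 0 ∧
      0 < (Matrix.of ![t, d, p]).det ∧ lorentz t d = 0 := by
  have sign : ∀ a : ℝ, a ≠ 0 → ∃ ε : ℝ, ε * ε = 1 ∧ 0 < ε * a := by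
    intro a ha
    rcases lt_or_gt_of_ne ha with h | h
    · exact ⟨-1, by norm_num, by linarith⟩
    · exact ⟨1, by norm_num, by linarith⟩
  obtain ⟨q, hqx, hqy, hqq, hdet⟩ : ∃ q : Fin 3 → ℝ, lorentz q x = 0 ∧ lorentz q y = 0 ∧
      lorentz q q = -1 ∧ (Matrix.of ![y, x, q]).det = 1 := by
    refine ⟨![x 1 * y 2 - x 2 * y 1, x 2 * y 0 - x 0 * y 2, -(x 0 * y 1 - x 1 * y 0)], ?_, ?_, ?_, ?_⟩
    · simp [lorentz]; ring
    · simp [lorentz]; ring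
    · have : lorentz x y ^ 2 - lorentz x x * lorentz y y = -1 := by rw [hxx, hyy, hxy]; norm_num
      rw [← this]; simp [lorentz]; ring
    · have : lorentz x x * lorentz y y - lorentz x y ^ 2 = 1 := by rw [hxx, hyy, hxy]; norm_num
      rw [← this]; simp [lorentz, Matrix.det_fin_three]; ring
  have hq2 : q 2 ≠ 0 := by
    intro h
    simp only [lorentz, h] at hqq
    nlinarith [mul_self_nonneg (q 0), mul_self_nonneg (q 1)]
  obtain ⟨ε, hε, hε'⟩ := sign _ hq2
  obtain ⟨δ, hδ, hδ'⟩ := sign _ hya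
  have hd : (Matrix.of ![δ • y, x, ε • q]).det ≠ 0 := by
    rw [det_smul_first, det_smul_third, hdet]
    exact mul_ne_zero (by rintro rfl; simp at hδ) (mul_ne_zero (by rintro rfl; simp at hε) one_ne_zero)
  obtain ⟨κ, hκ, hκ'⟩ := sign _ hd
  -- The geodesic with pole `x` has tangent `±y` at the crossing point, and conversely. The three
  -- signs put the point in the future sheet, direct `t` by `a`, and orient the frame.
  refine ⟨ε • q, δ • y, κ • x, ?_, hε', ?_, ?_, ?_, ?_, ?_, ?_, ?_, ?_, ?_, ?_, ?_⟩ <;>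
    try simp only [lorentz_smul_left, lorentz_smul_right, hqq, hqx, hqy, hxx, hyy, hxy,
      lorentz_comm y q, lorentz_comm x q, lorentz_comm y x, mul_zero, mul_one, hδ, hκ, hδ']
  · linarith
  · rwa [det_smul_second]

end LorentzianAlgebra

/-! ### Null frames of hyperbolic elements. -/

section NullFrame

variable {A : GL (Fin 3) ℝ}

/-- The fixed vector is orthogonal to both null eigenvectors, hence not timelike; nor can it be
null, as it would then be orthogonal to a basis. So it can be scaled to a unit vector, with the sign
fixed by the determinant. -/
theorem exists_isNullFrame_of_lt_one (hA : A ∈ SO21) {s : ℝ} {x y z : Fin 3 → ℝ}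
    (hs0 : 0 < s) (hs : s < 1)
    (hx : A.1 *ᵥ x = x) (hy : A.1 *ᵥ y = s • y) (hz : A.1 *ᵥ z = s⁻¹ • z)
    (hy' : IsUnitFutureNull y) (hz' : IsUnitFutureNull z)
    (hdet : (Matrix.of ![x, y, z]).det ≠ 0) :
    ∃ X0 Xm Xp, IsNullFrame A X0 Xm Xp := by
  have hxy : lorentz x y = 0 := by
    have := hA.1 x y
    rw [hx, hy, lorentz_smul_right] at this
    exact (mul_eq_zero.1 (show (1 - s) * lorentz x y = 0 by linarith)).resolve_left (by linarith)
  have hxz : lorentz x z = 0 := by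
    have := hA.1 x z
    rw [hx, hz, lorentz_smul_right] at this
    have h1 : 1 < s⁻¹ := (one_lt_inv₀ hs0).2 hs
    exact (mul_eq_zero.1 (show (1 - s⁻¹) * lorentz x z = 0 by linarith)).resolve_left
      (by linarith)
  have hx0 : x ≠ 0 := by
    rintro rfl
    apply hdet
    simp [Matrix.det_fin_three]
  have hxx : 0 < lorentz x x := by
    refine lt_of_le_of_ne (lorentz_self_nonneg_of_orthogonal hy' hxy) fun h => hx0 ?_
    refine eq_zero_of_lorentz_eq_zero fun v => ?_
    obtain ⟨α, β, γ, rfl⟩ := exists_coordinates hdet v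
    simp only [lorentz_add_right, lorentz_smul_right, hxy, hxz, ← h]
    ring
  have key : ∀ a : ℝ, a * a * lorentz x x = 1 → 0 < a * (Matrix.of ![x, y, z]).det →
      ∃ X0 Xm Xp, IsNullFrame A X0 Xm Xp := fun a ha ha' =>
    ⟨a • x, y, z, ⟨s, hs0, hs, hy, hz⟩, hy', hz', by rw [Matrix.mulVec_smul, hx],
      by rw [lorentz_smul_left, lorentz_smul_right, ← mul_assoc, ha],
      by rwa [det_smul_first]⟩
  have hq : (Real.sqrt (lorentz x x))⁻¹ * (Real.sqrt (lorentz x x))⁻¹ * lorentz x x = 1 := by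
    rw [← mul_inv, Real.mul_self_sqrt hxx.le, inv_mul_cancel₀ hxx.ne']
  have hq0 : 0 < (Real.sqrt (lorentz x x))⁻¹ := inv_pos.2 (Real.sqrt_pos.2 hxx)
  rcases lt_or_gt_of_ne hdet with h | h
  · exact key (-(Real.sqrt (lorentz x x))⁻¹) (by linarith) (by nlinarith)
  · exact key (Real.sqrt (lorentz x x))⁻¹ hq (by positivity)

/-- Because `A` preserves the time orientation, it sends future null vectors to future null vectors;
the vector `(0,0,1)` is used to detect this. -/
theorem SO21.eigenvalue_pos (hA : A ∈ SO21) {s : ℝ} {y : Fin 3 → ℝ}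
    (hy : A.1 *ᵥ y = s • y) (hy' : IsUnitFutureNull y) : 0 < s := by
  have e : (A.1 *ᵥ Pi.single 2 1) 2 = A.1 2 2 := by simp
  have h1 : lorentz (A.1 *ᵥ Pi.single 2 1) (A.1 *ᵥ Pi.single 2 1) < 0 := by
    rw [hA.1]; simp [lorentz]
  have h2 : lorentz (A.1 *ᵥ y) (A.1 *ᵥ Pi.single 2 1) < 0 := by
    rw [hA.1]; simpa [lorentz] using hy'.2.1
  have h3 : 0 < (A.1 *ᵥ y) 2 :=
    pos_of_lorentz_neg h1 (by rw [e]; exact hA.2.2) (by rw [hA.1]; exact hy'.1) h2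
  rw [hy, Pi.smul_apply, smul_eq_mul] at h3
  exact pos_of_mul_pos_left h3 hy'.2.1.le

theorem exists_isNullFrame_of_eigenvectors (hA : A ∈ SO21) {s t : ℝ} {x y z : Fin 3 → ℝ}
    (hst : s * t = 1) (hne : s ≠ t)
    (hx : A.1 *ᵥ x = x) (hy : A.1 *ᵥ y = s • y) (hz : A.1 *ᵥ z = t • z)
    (hdet : (Matrix.of ![x, y, z]).det ≠ 0) :
    ∃ X0 Xm Xp, IsNullFrame A X0 Xm Xp := by
  have null : ∀ {s t : ℝ} {y : Fin 3 → ℝ}, s * t = 1 → s ≠ t → A.1 *ᵥ y = s • y →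
      lorentz y y = 0 := by
    intro s t y hst hne hy
    have := hA.1 y y
    rw [hy, lorentz_smul_left, lorentz_smul_right] at this
    refine (mul_eq_zero.1 (show (s - t) * (s * lorentz y y) = 0 by
      linear_combination this - lorentz y y * hst)).resolve_left (sub_ne_zero.2 hne)
      |> mul_eq_zero.1 |>.resolve_left ?_
    rintro rfl
    simp at hst
  have hy0 : y ≠ 0 := by rintro rfl; apply hdet; simp [Matrix.det_fin_three]
  have hz0 : z ≠ 0 := by rintro rfl; apply hdet; simp [Matrix.det_fin_three]
  obtain ⟨a, ha, hay⟩ := exists_smul_isUnitFutureNull hy0 (null hst hne hy)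
  obtain ⟨c, hc, hcz⟩ := exists_smul_isUnitFutureNull hz0
    (null ((mul_comm t s).trans hst) hne.symm hz)
  have hy1 : A.1 *ᵥ (a • y) = s • (a • y) := by rw [Matrix.mulVec_smul, hy, smul_comm]
  have hz1 : A.1 *ᵥ (c • z) = t • (c • z) := by rw [Matrix.mulVec_smul, hz, smul_comm]
  have hs0 := SO21.eigenvalue_pos hA hy1 hay
  have ht0 := SO21.eigenvalue_pos hA hz1 hcz
  have hdet1 : (Matrix.of ![x, a • y, c • z]).det ≠ 0 := by
    rw [det_smul_second, det_smul_third]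
    exact mul_ne_zero ha (mul_ne_zero hc hdet)
  obtain rfl : t = s⁻¹ := eq_inv_of_mul_eq_one_right hst
  rcases lt_trichotomy s 1 with h | h | h
  · exact exists_isNullFrame_of_lt_one hA hs0 h hx hy1 hz1 hay hcz hdet1
  · subst h; simp at hne
  · refine exists_isNullFrame_of_lt_one hA ht0 (inv_lt_one_of_one_lt₀ h) hx hz1 ?_ hcz hay ?_
    · rwa [inv_inv]
    · rw [det_swap_second_third]; exact neg_ne_zero.2 hdet1

/-- Eigenvectors for `s` and `t` are orthogonal unless `s t = 1`, so nondegeneracy pairs every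
eigenvalue with an inverse. If two distinct eigenvalues are inverse to each other, determinant one
makes the third equal to `1`. Otherwise all three square to `1`, which is impossible for distinct
reals. -/
theorem exists_isNullFrame (hA : A ∈ SO21) (h : IsHyperbolic A) :
    ∃ X0 Xm Xp, IsNullFrame A X0 Xm Xp := by
  obtain ⟨a, b, c, hab, hbc, ha, hb, hc⟩ := h
  obtain ⟨x, hx⟩ := ha.exists_hasEigenvector
  obtain ⟨y, hy⟩ := hb.exists_hasEigenvector
  obtain ⟨z, hz⟩ := hc.exists_hasEigenvector
  have hli : LinearIndependent ℝ ![x, y, z] := by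
    refine Module.End.eigenvectors_linearIndependent' (Matrix.toLin' A.1) ![a, b, c] ?_ _ ?_
    · intro i j hij
      fin_cases i <;> fin_cases j <;> simp at hij ⊢ <;> linarith
    · intro i
      fin_cases i <;> assumption
  have hdet : (Matrix.of ![x, y, z]).det ≠ 0 :=
    isUnit_iff_ne_zero.1 ((Matrix.isUnit_iff_isUnit_det _).1
      (Matrix.linearIndependent_rows_iff_isUnit.1 hli))
  have hx1 : A.1 *ᵥ x = a • x := by simpa using hx.apply_eq_smul
  have hy1 : A.1 *ᵥ y = b • y := by simpa using hy.apply_eq_smul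
  have hz1 : A.1 *ᵥ z = c • z := by simpa using hz.apply_eq_smul
  have hprod : a * b * c = 1 := by
    have e : Matrix.of ![x, y, z] * A.1ᵀ = Matrix.of ![a • x, b • y, c • z] := by
      ext i j
      rw [← hx1, ← hy1, ← hz1]
      fin_cases i <;>
        simp [Matrix.mul_apply, Matrix.mulVec, dotProduct, mul_comm]
    have e2 := congrArg Matrix.det e
    rw [Matrix.det_mul, Matrix.det_transpose, hA.2.1, det_smul_first, det_smul_second,
      det_smul_third] at e2
    have := mul_right_cancel₀ hdet (show (a * b * c) * _ = 1 * _ by rw [one_mul]; linarith)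
    exact this
  have ortho : ∀ {s t : ℝ} {v w : Fin 3 → ℝ}, A.1 *ᵥ v = s • v → A.1 *ᵥ w = t • w →
      s * t ≠ 1 → lorentz v w = 0 := by
    intro s t v w hv hw hne
    have := hA.1 v w
    rw [hv, hw, lorentz_smul_left, lorentz_smul_right] at this
    exact (mul_eq_zero.1 (show (s * t - 1) * lorentz v w = 0 by linarith)).resolve_left
      (sub_ne_zero.2 hne)
  have nondeg : ∀ {s : ℝ} {v : Fin 3 → ℝ}, A.1 *ᵥ v = s • v → v ≠ 0 →
      s * a = 1 ∨ s * b = 1 ∨ s * c = 1 := by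
    intro s v hv hv0
    by_contra! h
    refine hv0 (eq_zero_of_lorentz_eq_zero fun w => ?_)
    obtain ⟨α, β, γ, rfl⟩ := exists_coordinates hdet w
    simp only [lorentz_add_right, lorentz_smul_right, ortho hv hx1 h.1, ortho hv hy1 h.2.1,
      ortho hv hz1 h.2.2]
    ring
  by_cases h1 : b * c = 1
  · have : a = 1 := by rw [mul_assoc, h1, mul_one] at hprod; exact hprod
    subst this
    exact exists_isNullFrame_of_eigenvectors hA h1 hbc.ne (by simpa using hx1) hy1 hz1 hdet
  by_cases h2 : a * c = 1
  · have : b = 1 := by linear_combination hprod - b * h2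
    subst this
    refine exists_isNullFrame_of_eigenvectors hA ((mul_comm c a).trans h2) (by linarith)
      (by simpa using hy1) hz1 hx1 ?_
    rwa [det_rotate]
  by_cases h3 : a * b = 1
  · have : c = 1 := by linear_combination hprod - c * h3
    subst this
    refine exists_isNullFrame_of_eigenvectors hA h3 hab.ne
      (by simpa using hz1) hx1 hy1 ?_
    rwa [← det_rotate]
  · have qa : a * a = 1 := by
      rcases nondeg hx1 hx.2 with h | h | h
      · exact h
      · exact (h3 h).elim
      · exact (h2 h).elim
    have qb : b * b = 1 := by
      rcases nondeg hy1 hy.2 with h | h | h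
      · exact (h3 ((mul_comm a b).trans h)).elim
      · exact h
      · exact (h1 h).elim
    have qc : c * c = 1 := by
      rcases nondeg hz1 hz.2 with h | h | h
      · exact (h2 ((mul_comm a c).trans h)).elim
      · exact (h1 ((mul_comm b c).trans h)).elim
      · exact h
    have e1 : a + b = 0 :=
      (mul_eq_zero.1 (show (a - b) * (a + b) = 0 by linarith)).resolve_left (by linarith)
    have e2 : b + c = 0 :=
      (mul_eq_zero.1 (show (b - c) * (b + c) = 0 by linarith)).resolve_left (by linarith)
    linarith

namespace IsNullFrame

variable {X0 Xm Xp : Fin 3 → ℝ}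

theorem coordinates (h : IsNullFrame A X0 Xm Xp) (v : Fin 3 → ℝ) :
    ∃ α β γ : ℝ, v = α • X0 + β • Xm + γ • Xp :=
  exists_coordinates h.2.2.2.2.2.ne' v

theorem ne_zero (h : IsNullFrame A X0 Xm Xp) : X0 ≠ 0 := by
  rintro rfl
  have := h.2.2.2.2.1
  simp [lorentz] at this

/-- Fixed vectors are orthogonal to the null directions. -/
theorem orthogonal_of_fixed (hA : A ∈ SO21) (h : IsNullFrame A X0 Xm Xp) {v : Fin 3 → ℝ}
    (hv : A.1 *ᵥ v = v) : lorentz v Xm = 0 ∧ lorentz v Xp = 0 := by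
  obtain ⟨⟨r, hr0, hr1, hm, hp⟩, -⟩ := h
  constructor
  · have := hA.1 v Xm
    rw [hv, hm, lorentz_smul_right] at this
    exact (mul_eq_zero.1 (show (1 - r) * lorentz v Xm = 0 by linarith)).resolve_left (by linarith)
  · have := hA.1 v Xp
    rw [hv, hp, lorentz_smul_right] at this
    have h1 : 1 < r⁻¹ := (one_lt_inv₀ hr0).2 hr1
    exact (mul_eq_zero.1 (show (1 - r⁻¹) * lorentz v Xp = 0 by linarith)).resolve_left
      (by linarith)

theorem lorentz_minus_plus_ne_zero (hA : A ∈ SO21) (h : IsNullFrame A X0 Xm Xp) :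
    lorentz Xm Xp ≠ 0 := by
  intro h0
  have : Xm = 0 := by
    refine eq_zero_of_lorentz_eq_zero fun w => ?_
    obtain ⟨α, β, γ, rfl⟩ := h.coordinates w
    simp only [lorentz_add_right, lorentz_smul_right, h0, h.2.1.1, lorentz_comm Xm X0,
      (h.orthogonal_of_fixed hA h.2.2.2.1).1]
    ring
  have h2 := h.2.1.2.1
  rw [this] at h2
  simp at h2

theorem eq_smul_of_fixed (hA : A ∈ SO21) (h : IsNullFrame A X0 Xm Xp) {v : Fin 3 → ℝ}
    (hv : A.1 *ᵥ v = v) : ∃ α : ℝ, v = α • X0 := by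
  obtain ⟨h1, h2⟩ := h.orthogonal_of_fixed hA hv
  obtain ⟨h3, h4⟩ := h.orthogonal_of_fixed hA h.2.2.2.1
  obtain ⟨α, β, γ, rfl⟩ := h.coordinates v
  have hmp := h.lorentz_minus_plus_ne_zero hA
  rw [lorentz_add_left, lorentz_add_left, lorentz_smul_left, lorentz_smul_left,
    lorentz_smul_left, h3, h.2.1.1, lorentz_comm Xp] at h1
  rw [lorentz_add_left, lorentz_add_left, lorentz_smul_left, lorentz_smul_left,
    lorentz_smul_left, h4, h.2.2.1.1] at h2
  have hγ : γ = 0 := (mul_eq_zero.1 (show γ * lorentz Xm Xp = 0 by linarith)).resolve_right hmp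
  have hβ : β = 0 := (mul_eq_zero.1 (show β * lorentz Xm Xp = 0 by linarith)).resolve_right hmp
  exact ⟨α, by rw [hγ, hβ]; simp⟩

/-- Vectors orthogonal to the neutral vector are displacements of the linear map. -/
theorem exists_eq_sub_of_orthogonal (hA : A ∈ SO21) (h : IsNullFrame A X0 Xm Xp) {w : Fin 3 → ℝ}
    (hw : lorentz w X0 = 0) : ∃ v, w = v - A.1 *ᵥ v := by
  obtain ⟨h3, h4⟩ := h.orthogonal_of_fixed hA h.2.2.2.1
  obtain ⟨α, β, γ, rfl⟩ := h.coordinates w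
  rw [lorentz_add_left, lorentz_add_left, lorentz_smul_left, lorentz_smul_left,
    lorentz_smul_left, lorentz_comm Xm, lorentz_comm Xp, h3, h4, h.2.2.2.2.1] at hw
  obtain ⟨⟨r, hr0, hr1, hm, hp⟩, -⟩ := h
  have h1 : 1 < r⁻¹ := (one_lt_inv₀ hr0).2 hr1
  refine ⟨(β / (1 - r)) • Xm + (γ / (1 - r⁻¹)) • Xp, ?_⟩
  have hα : α = 0 := by linarith
  have hr' : 1 - r ≠ 0 := by linarith
  have hr'' : 1 - r⁻¹ ≠ 0 := by linarith
  rw [Matrix.mulVec_add, Matrix.mulVec_smul, Matrix.mulVec_smul, hm, hp, hα]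
  have eβ : β = β / (1 - r) * (1 - r) := (div_mul_cancel₀ _ hr').symm
  have eγ : γ = γ / (1 - r⁻¹) * (1 - r⁻¹) := (div_mul_cancel₀ _ hr'').symm
  ext i
  simp only [Pi.add_apply, Pi.sub_apply, Pi.smul_apply, smul_eq_mul]
  linear_combination Xm i * eβ + Xp i * eγ

/-- A hyperbolic isometry that fixes the neutral vector of `A` commutes with `A`. -/
theorem commute_of_fixed (hA : A ∈ SO21) (h : IsNullFrame A X0 Xm Xp)
    {B : GL (Fin 3) ℝ} (hB : B ∈ SO21) {Y0 Ym Yp : Fin 3 → ℝ} (k : IsNullFrame B Y0 Ym Yp)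
    (hf : B.1 *ᵥ X0 = X0) : A * B = B * A := by
  obtain ⟨h3, h4⟩ := h.orthogonal_of_fixed hA h.2.2.2.1
  have hmp := h.lorentz_minus_plus_ne_zero hA
  -- The plane orthogonal to `X0` contains only two null lines, so `B`, which fixes `X0`, must
  -- preserve or exchange them.
  have null : ∀ v, lorentz v v = 0 → lorentz X0 v = 0 →
      (∃ β : ℝ, v = β • Xm) ∨ ∃ γ : ℝ, v = γ • Xp := by
    intro v hv hv0
    obtain ⟨α, β, γ, rfl⟩ := h.coordinates v
    simp only [lorentz_add_right, lorentz_smul_right, h3, h4, h.2.2.2.2.1] at hv0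
    have hα : α = 0 := by linarith
    subst hα
    simp only [lorentz_add_right, lorentz_smul_right, lorentz_add_left, lorentz_smul_left, h3, h4,
      h.2.1.1, h.2.2.1.1, lorentz_comm Xp Xm] at hv
    have hv' : β * (γ * lorentz Xm Xp) = 0 := by linarith
    rcases mul_eq_zero.1 hv' with h | h
    · right; exact ⟨γ, by rw [h]; simp⟩
    · left; exact ⟨β, by rw [(mul_eq_zero.1 h).resolve_right hmp]; simp⟩
  have hpair := hB.1 Xm Xp
  have hm := null (B.1 *ᵥ Xm) (by rw [hB.1]; exact h.2.1.1) (by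
    have := hB.1 X0 Xm; rwa [hf, h3] at this)
  have hp := null (B.1 *ᵥ Xp) (by rw [hB.1]; exact h.2.2.1.1) (by
    have := hB.1 X0 Xp; rwa [hf, h4] at this)
  have diag : (∃ β : ℝ, B.1 *ᵥ Xm = β • Xm) ∧ ∃ γ : ℝ, B.1 *ᵥ Xp = γ • Xp := by
    rcases hm with ⟨β, hm⟩ | ⟨β, hm⟩ <;> rcases hp with ⟨γ, hp⟩ | ⟨γ, hp⟩
    · rw [hm, hp, lorentz_smul_left, lorentz_smul_right, h.2.1.1] at hpair
      exact (hmp (by linarith)).elim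
    · exact ⟨⟨β, hm⟩, ⟨γ, hp⟩⟩
    -- If `B` exchanged the null lines, it would fix `Xm + β Xp` in addition to `X0`; but the fixed
    -- space of a hyperbolic element is a line.
    · exfalso
      rw [hm, hp, lorentz_smul_left, lorentz_smul_right, lorentz_comm Xp] at hpair
      have hβγ : β * γ = 1 := mul_right_cancel₀ hmp (by linarith)
      have hv : B.1 *ᵥ (Xm + β • Xp) = Xm + β • Xp := by
        rw [Matrix.mulVec_add, Matrix.mulVec_smul, hm, hp, smul_smul, hβγ, one_smul, add_comm]
      obtain ⟨s, hs⟩ := k.eq_smul_of_fixed hB hv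
      obtain ⟨t, ht⟩ := k.eq_smul_of_fixed hB hf
      have e1 : lorentz X0 (Xm + β • Xp) = 0 := by
        rw [lorentz_add_right, lorentz_smul_right, h3, h4]; ring
      rw [hs, ht, lorentz_smul_right, lorentz_smul_left, k.2.2.2.2.1] at e1
      have ht0 : t ≠ 0 := by
        rintro rfl
        exact h.ne_zero (by rw [ht, zero_smul])
      have hs0 : s = 0 := by
        rcases mul_eq_zero.1 e1 with h | h
        · exact h
        · exact (ht0 (by linarith)).elim
      rw [hs0, zero_smul] at hs
      have e2 : lorentz (Xm + β • Xp) Xp = 0 := by rw [hs, lorentz_zero_left]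
      rw [lorentz_add_left, lorentz_smul_left, h.2.2.1.1] at e2
      exact hmp (by linarith)
    · rw [hm, hp, lorentz_smul_left, lorentz_smul_right, h.2.2.1.1] at hpair
      exact (hmp (by linarith)).elim
  obtain ⟨⟨β, hβ⟩, ⟨γ, hγ⟩⟩ := diag
  have hX := h.2.2.2.1
  obtain ⟨r, -, -, hr, hr'⟩ := h.1
  apply Units.ext
  show A.1 * B.1 = B.1 * A.1
  refine Matrix.toLin'.injective (LinearMap.ext fun v => ?_)
  obtain ⟨a, b, c, rfl⟩ := h.coordinates v
  simp only [Matrix.toLin'_apply, ← Matrix.mulVec_mulVec, Matrix.mulVec_add, Matrix.mulVec_smul,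
    hf, hX, hβ, hγ, hr, hr']
  module

end IsNullFrame

/-! ### Vectors of the chosen frames -/

theorem isNullFrame_neutralVector (hA : A ∈ SO21) (h : IsHyperbolic A) :
    ∃ Xm Xp, IsNullFrame A (neutralVector A) Xm Xp :=
  Classical.epsilon_spec (p := fun X0 => ∃ Xm Xp, IsNullFrame A X0 Xm Xp)
    (exists_isNullFrame hA h)

theorem isNullFrame_attractingVector (hA : A ∈ SO21) (h : IsHyperbolic A) :
    ∃ X0 Xm, IsNullFrame A X0 Xm (attractingVector A) := by
  refine Classical.epsilon_spec (p := fun Xp => ∃ X0 Xm, IsNullFrame A X0 Xm Xp) ?_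
  obtain ⟨X0, Xm, Xp, h⟩ := exists_isNullFrame hA h
  exact ⟨Xp, X0, Xm, h⟩

/-- If the neutral vectors are orthogonal, then the axes cross at a right angle. -/
theorem isAxisAngle_pi_div_two (hA : A ∈ SO21) (h : IsHyperbolic A)
    {B : GL (Fin 3) ℝ} (hB : B ∈ SO21) (k : IsHyperbolic B)
    (h0 : lorentz (neutralVector A) (neutralVector B) = 0) :
    IsAxisAngle A B (Real.pi / 2) := by
  obtain ⟨Xm, Xp, hX⟩ := isNullFrame_neutralVector hA h
  obtain ⟨Ym, Yp, hY⟩ := isNullFrame_neutralVector hB k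
  obtain ⟨Z0, Zm, hZ⟩ := isNullFrame_attractingVector hA h
  have hxx := hX.2.2.2.2.1
  have hyy := hY.2.2.2.2.1
  -- The tangent of the axis of `A` will be `±` the neutral vector of `B`, so this pairing decides
  -- its direction. Were it zero, the neutral vector of `B` would be a multiple of the attracting
  -- vector, hence null.
  have hna : lorentz (neutralVector B) (attractingVector A) ≠ 0 := by
    intro hna
    obtain ⟨s, hs⟩ := hX.eq_smul_of_fixed hA hZ.2.2.2.1
    obtain ⟨h3, h4⟩ := hZ.orthogonal_of_fixed hA hZ.2.2.2.1
    have hyz : lorentz (neutralVector B) Z0 = 0 := by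
      rw [hs, lorentz_smul_right, lorentz_comm, h0, mul_zero]
    obtain ⟨α, β, γ, e⟩ := hZ.coordinates (neutralVector B)
    rw [e, lorentz_add_left, lorentz_add_left, lorentz_smul_left, lorentz_smul_left,
      lorentz_smul_left, h4, hZ.2.2.1.1] at hna
    have hβ : β = 0 := (mul_eq_zero.1 (show β * lorentz Zm _ = 0 by
      linarith)).resolve_right (hZ.lorentz_minus_plus_ne_zero hA)
    rw [e, lorentz_add_left, lorentz_add_left, lorentz_smul_left, lorentz_smul_left,
      lorentz_smul_left, hZ.2.2.2.2.1, lorentz_comm Zm, lorentz_comm (attractingVector A), h3, h4]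
      at hyz
    have hα : α = 0 := by linarith
    rw [e, hα, hβ] at hyy
    simp only [zero_smul, zero_add, lorentz_smul_left, lorentz_smul_right, hZ.2.2.1.1] at hyy
    linarith
  obtain ⟨p, t, d, hpp, hp, hpx, hpy, htp, htt, htx, hta, hdp, hdd, hdy, hdet, htd⟩ :=
    exists_orthogonal_crossing hxx hyy h0 hna
  exact ⟨p, t, d, ⟨hpp, hp, hpx⟩, ⟨hpp, hp, hpy⟩, ⟨htp, htt, htx⟩, hta, ⟨hdp, hdd, hdy⟩, hdet,
    by positivity, by linarith [Real.pi_pos], by rw [Real.cos_pi_div_two, htd]⟩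

end NullFrame

/-! ### Freeness of the surface group. -/

section SurfaceGroup

variable {g b : ℕ}

/-- The relator is the first boundary loop times a word in which that loop does not occur. The
absence is expressed through `FreeGroup.lift`, the form in which it is used. -/
theorem planarLoops_eq_cons (hb : 0 < b) :
    ∃ l : List (FreeGroup (SurfaceGen g b)),
      planarLoops g b = FreeGroup.of (SurfaceGen.bdry ⟨0, hb⟩) :: l ∧
      ∀ w ∈ l, ∀ (H : Type) [Group H] (f f' : SurfaceGen g b → H),
        (∀ x, x ≠ .bdry ⟨0, hb⟩ → f x = f' x) → FreeGroup.lift f w = FreeGroup.lift f' w := by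
  obtain ⟨b, rfl⟩ : ∃ b', b = b' + 1 := ⟨b - 1, by omega⟩
  rw [planarLoops, List.ofFn_succ]
  refine ⟨_, rfl, fun w hw H _ f f' h => ?_⟩
  rcases List.mem_append.1 hw with hw | hw
  · obtain ⟨i, rfl⟩ := (List.mem_ofFn' _ _).1 hw
    simp only [FreeGroup.lift_apply_of]
    exact h _ fun e => Fin.succ_ne_zero i (SurfaceGen.bdry.inj e)
  · obtain ⟨j, rfl⟩ := (List.mem_ofFn' _ _).1 hw
    simp only [map_mul, map_inv, FreeGroup.lift_apply_of]
    rw [h (.lon j) (by simp), h (.mer j) (by simp)]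

/-- The fundamental group is free on all generators but the first boundary loop: every assignment
extends to a homomorphism, up to its value on that loop. -/
theorem SurfaceGroup.exists_hom (hb : 0 < b) {H : Type} [Group H] (f : SurfaceGen g b → H) :
    ∃ φ : SurfaceGroup g b →* H,
      ∀ x, x ≠ .bdry ⟨0, hb⟩ → φ (PresentedGroup.of x) = f x := by
  classical
  obtain ⟨l, hl, hl'⟩ := planarLoops_eq_cons (g := g) hb
  set f' := Function.update f (.bdry ⟨0, hb⟩) ((FreeGroup.lift f) l.prod)⁻¹ with hf'
  have hff' : ∀ x, x ≠ .bdry ⟨0, hb⟩ → f' x = f x := fun x hx => Function.update_of_ne hx _ _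
  refine ⟨PresentedGroup.toGroup (f := f') ?_, fun x hx => ?_⟩
  · rintro r rfl
    rw [hl, List.prod_cons, map_mul, FreeGroup.lift_apply_of]
    have e : (FreeGroup.lift f') l.prod = (FreeGroup.lift f) l.prod := by
      rw [map_list_prod, map_list_prod]
      congr 1
      exact List.map_congr_left fun w hw => hl' w hw H _ _ hff'
    rw [e, hf', Function.update_self, inv_mul_cancel]
  · rw [PresentedGroup.toGroup.of, hff' x hx]

end SurfaceGroup

/-! ### The marked Fuchsian group and its cocycles. -/

namespace HyperbolicSurface

variable {g b : ℕ} (S : HyperbolicSurface g b)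

theorem exists_hom (hb : 0 < b) {H : Type} [Group H] (f : SurfaceGen g b → H) :
    ∃ φ : S.G →* H, ∀ x, x ≠ .bdry ⟨0, hb⟩ → φ (S.elt (FreeGroup.of x)) = f x := by
  obtain ⟨φ, hφ⟩ := SurfaceGroup.exists_hom hb f
  refine ⟨φ.comp S.marking.symm.toMonoidHom, fun x hx => ?_⟩
  rw [← hφ x hx]
  show φ (S.marking.symm (S.marking _)) = _
  rw [MulEquiv.symm_apply_apply]
  rfl

theorem elt_mul (v w : FreeGroup (SurfaceGen g b)) : S.elt (v * w) = S.elt v * S.elt w := by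
  simp only [elt, map_mul]

theorem elt_inv (v : FreeGroup (SurfaceGen g b)) : S.elt v⁻¹ = (S.elt v)⁻¹ := by
  simp only [elt, map_inv]

theorem elt_one : S.elt 1 = 1 := by simp only [elt, map_one]

/-! ### The planar loops and their partial products -/

/-- The `i`-th of the loops bounding the planar part. -/
def loop (i : ℕ) : S.G := S.elt ((planarLoops g b).getD i 1)

/-- The product of the first `k` planar loops. -/
def head (k : ℕ) : S.G := S.elt ((planarLoops g b).take k).prod

theorem length_planarLoops : (planarLoops g b).length = b + g := by
  simp [planarLoops]

theorem loop_bdry (i : Fin b) : S.loop i = S.elt (FreeGroup.of (.bdry i)) := by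
  simp [loop, planarLoops, List.getD_eq_getElem?_getD, List.getElem?_append]

theorem loop_handle (j : Fin g) :
    S.loop (b + j) = S.lon j * S.mer j * (S.lon j)⁻¹ * (S.mer j)⁻¹ := by
  simp [loop, planarLoops, List.getD_eq_getElem?_getD, lon, mer, elt_mul,
    elt_inv]

theorem head_zero : S.head 0 = 1 := by simp [head, elt_one]

theorem head_succ (k : ℕ) : S.head (k + 1) = S.head k * S.loop k := by
  rw [head, head, loop, ← elt_mul, List.take_add_one, List.prod_append,
    List.getD_eq_getElem?_getD]
  congr 2
  cases (planarLoops g b)[k]? <;> simp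

theorem head_one : S.head 1 = S.loop 0 := by rw [head_succ, head_zero, one_mul]

/-- This is the surface relation. -/
theorem head_last : S.head (b + g) = 1 := by
  have h : PresentedGroup.mk {(planarLoops g b).prod} (planarLoops g b).prod = 1 :=
    PresentedGroup.mk_eq_one_iff.2 (Subgroup.subset_normalClosure rfl)
  rw [head, ← length_planarLoops, List.take_length, elt, h, map_one]

theorem div_planar (k : Fin (g + b - 3)) : S.div (.planar k) = (S.head (k + 2))⁻¹ := rfl

theorem div_handle (j : Fin g) (h : 3 ≤ g + b) : S.div (.handle j h) = S.loop (b + j) :=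
  (S.loop_handle j).symm

theorem head_mem_of_head_mem {Q : Subgroup S.G} {k m : ℕ} (hkm : k ≤ m) (hm : S.head m ∈ Q)
    (h : ∀ i, k ≤ i → i < m → S.loop i ∈ Q) : S.head k ∈ Q := by
  induction m, hkm using Nat.le_induction with
  | base => exact hm
  | succ m hkm ih =>
    refine ih ?_ fun i hi hi' => h i hi (by omega)
    rw [head_succ] at hm
    exact (Subgroup.mul_mem_cancel_right Q (h m hkm (by omega))).1 hm

/-- A partial product is, up to inversion, the product of the complementary loops. -/
theorem head_mem_of_tail {Q : Subgroup S.G} {k : ℕ} (hk : k ≤ b + g)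
    (h : ∀ i, k ≤ i → i < b + g → S.loop i ∈ Q) : S.head k ∈ Q :=
  S.head_mem_of_head_mem hk (by rw [head_last]; exact Q.one_mem) h

/-- A loop lies in every subgroup that contains the generators at its position. -/
theorem loop_mem {Q : Subgroup S.G} {i : ℕ} (hi : i < b + g)
    (h : ∀ x : SurfaceGen g b, x.pos = i → S.elt (FreeGroup.of x) ∈ Q) : S.loop i ∈ Q := by
  rcases lt_or_ge i b with hib | hib
  · have := S.loop_bdry ⟨i, hib⟩
    rw [show S.loop i = _ from this]
    exact h _ rfl
  · have e := S.loop_handle ⟨i - b, by omega⟩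
    rw [show b + (⟨i - b, by omega⟩ : Fin g).1 = i by simp; omega] at e
    rw [e]
    have h1 := h (.lon ⟨i - b, by omega⟩) (by simp [SurfaceGen.pos]; omega)
    have h2 := h (.mer ⟨i - b, by omega⟩) (by simp [SurfaceGen.pos]; omega)
    exact Q.mul_mem (Q.mul_mem (Q.mul_mem h1 h2) (Q.inv_mem h1)) (Q.inv_mem h2)

/-- The generators other than the first boundary loop generate the group. -/
theorem eq_top_of_generators_mem (hb : 0 < b) {Q : Subgroup S.G}
    (h : ∀ x, x ≠ .bdry ⟨0, hb⟩ → S.elt (FreeGroup.of x) ∈ Q) : Q = ⊤ := by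
  have h0 : S.elt (FreeGroup.of (.bdry ⟨0, hb⟩)) ∈ Q := by
    have : S.head 1 ∈ Q := by
      refine S.head_mem_of_tail (by omega) fun i hi hi' => S.loop_mem hi' fun x hx => h x ?_
      rintro rfl
      simp only [SurfaceGen.pos] at hx
      omega
    rwa [head_one, show S.loop 0 = _ from S.loop_bdry ⟨0, hb⟩] at this
  have hall : ∀ x, S.elt (FreeGroup.of x) ∈ Q := fun x => by
    by_cases hx : x = .bdry ⟨0, hb⟩
    · rw [hx]; exact h0
    · exact h x hx
  have : Q.comap S.marking.toMonoidHom = ⊤ := by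
    rw [← top_le_iff, ← PresentedGroup.closure_range_of, Subgroup.closure_le]
    rintro _ ⟨x, rfl⟩
    exact hall x
  rw [← top_le_iff]
  intro y _
  have h1 : S.marking.symm y ∈ Q.comap S.marking.toMonoidHom := by rw [this]; trivial
  have h2 : S.marking (S.marking.symm y) ∈ Q := h1
  rwa [MulEquiv.apply_symm_apply] at h2

/-! ### Cocycles -/

theorem val_mul (u : S.Z1) (h k : S.G) :
    S.val u (h * k) = S.val u h + h.1.1 *ᵥ S.val u k := by
  rw [add_comm]
  exact (groupCohomology.mem_cocycles₁_iff (A := S.rep) u.1).1 u.2 h k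

theorem val_add (u v : S.Z1) (h : S.G) : S.val (u + v) h = S.val u h + S.val v h := rfl

theorem val_smul (a : ℝ) (u : S.Z1) (h : S.G) : S.val (a • u) h = a • S.val u h := rfl

theorem val_ext {u v : S.Z1} (h : ∀ k, S.val u k = S.val v k) : u = v :=
  Subtype.ext (funext h)

/-- A function satisfying the cocycle identity, as a cocycle. -/
def mkCocycle (f : S.G → Fin 3 → ℝ) (h : ∀ h k, f (h * k) = f h + h.1.1 *ᵥ f k) : S.Z1 :=
  ⟨f, (groupCohomology.mem_cocycles₁_iff (A := S.rep) f).2 fun x y =>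
    (h x y).trans (add_comm (f x) (x.1.1 *ᵥ f y))⟩

theorem mulVec_mul (h k : S.G) (v : Fin 3 → ℝ) :
    (h * k).1.1 *ᵥ v = h.1.1 *ᵥ (k.1.1 *ᵥ v) := by
  rw [Matrix.mulVec_mulVec]; rfl

theorem mulVec_one (v : Fin 3 → ℝ) : (1 : S.G).1.1 *ᵥ v = v := Matrix.one_mulVec v

theorem mulVec_inv_mulVec (h : S.G) (v : Fin 3 → ℝ) : h.1.1 *ᵥ (h⁻¹.1.1 *ᵥ v) = v := by
  rw [← mulVec_mul, mul_inv_cancel, mulVec_one]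

theorem inv_mulVec_mulVec (h : S.G) (v : Fin 3 → ℝ) : h⁻¹.1.1 *ᵥ (h.1.1 *ᵥ v) = v := by
  rw [← mulVec_mul, inv_mul_cancel, mulVec_one]

theorem inv_mulVec_of_fixed {h : S.G} {v : Fin 3 → ℝ} (hv : h.1.1 *ᵥ v = v) :
    h⁻¹.1.1 *ᵥ v = v := by
  conv_lhs => rw [← hv]
  exact S.inv_mulVec_mulVec h v

/-- The coboundary `h ↦ v - h v`. -/
def coboundary : (Fin 3 → ℝ) →ₗ[ℝ] S.Z1 where
  toFun v := S.mkCocycle (fun h => v - h.1.1 *ᵥ v) fun h k => by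
    rw [mulVec_mul, Matrix.mulVec_sub]; abel
  map_add' v w := S.val_ext fun k => by
    show v + w - k.1.1 *ᵥ (v + w) = (v - k.1.1 *ᵥ v) + (w - k.1.1 *ᵥ w)
    rw [Matrix.mulVec_add]; abel
  map_smul' a v := S.val_ext fun k => by
    show a • v - k.1.1 *ᵥ (a • v) = a • (v - k.1.1 *ᵥ v)
    rw [Matrix.mulVec_smul, smul_sub]

theorem val_coboundary (v : Fin 3 → ℝ) (h : S.G) :
    S.val (S.coboundary v) h = v - h.1.1 *ᵥ v := rfl

theorem val_one (u : S.Z1) : S.val u 1 = 0 := by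
  have := S.val_mul u 1 1
  rw [mul_one, mulVec_one] at this
  simpa using this

/-- The subgroup on which the cocycles `u` and `v` agree. -/
def eqLocus (u v : S.Z1) : Subgroup S.G where
  carrier := {h | S.val u h = S.val v h}
  one_mem' := (S.val_one u).trans (S.val_one v).symm
  mul_mem' {h k} hh hk := by
    simp only [Set.mem_ofPred_eq] at *
    rw [val_mul, val_mul, hh, hk]
  inv_mem' {h} hh := by
    simp only [Set.mem_ofPred_eq] at *
    have key : ∀ w : S.Z1, S.val w h⁻¹ = - (h⁻¹.1.1 *ᵥ S.val w h) := fun w => by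
      have := S.val_mul w h⁻¹ h
      rw [inv_mul_cancel, val_one] at this
      exact eq_neg_of_add_eq_zero_left this.symm
    rw [key, key, hh]

theorem mem_eqLocus {u v : S.Z1} {h : S.G} : h ∈ S.eqLocus u v ↔ S.val u h = S.val v h := Iff.rfl

theorem eq_of_eq_generators (hb : 0 < b) {u v : S.Z1}
    (h : ∀ x, x ≠ .bdry ⟨0, hb⟩ →
      S.val u (S.elt (FreeGroup.of x)) = S.val v (S.elt (FreeGroup.of x))) : u = v := by
  have := S.eq_top_of_generators_mem hb (Q := S.eqLocus u v) h
  exact S.val_ext fun k => S.mem_eqLocus.1 (this ▸ Subgroup.mem_top k)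

/-- The affine map `v ↦ h v + w` as a permutation. -/
def affinePerm (h : S.G) (w : Fin 3 → ℝ) : Equiv.Perm (Fin 3 → ℝ) where
  toFun v := h.1.1 *ᵥ v + w
  invFun v := h⁻¹.1.1 *ᵥ (v - w)
  left_inv v := by simp only [add_sub_cancel_right, inv_mulVec_mulVec]
  right_inv v := by simp only [mulVec_inv_mulVec, sub_add_cancel]

/-- Cocycles can be prescribed on the generators other than the first boundary loop. -/
theorem exists_cocycle (hb : 0 < b) (f : SurfaceGen g b → Fin 3 → ℝ) :
    ∃ u : S.Z1, ∀ x, x ≠ .bdry ⟨0, hb⟩ → S.val u (S.elt (FreeGroup.of x)) = f x := by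
  -- A cocycle is the translation part of an affine action with the given linear part. The
  -- homomorphism goes to all permutations of `ℝ³`; the subgroup `Q` collects the elements acting
  -- affinely with the right linear part, and it contains the generators.
  obtain ⟨φ, hφ⟩ := S.exists_hom hb fun x => S.affinePerm (S.elt (FreeGroup.of x)) (f x)
  let Q : Subgroup S.G :=
    { carrier := {h | ∀ v, φ h v = h.1.1 *ᵥ v + φ h 0}
      one_mem' := fun v => by simp
      mul_mem' := fun {h k} hh hk v => by
        simp only [Set.mem_ofPred_eq] at hh hk
        rw [map_mul, Equiv.Perm.mul_apply, Equiv.Perm.mul_apply, hk v, hh, hh (φ k 0), mulVec_mul,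
          Matrix.mulVec_add, add_assoc]
      inv_mem' := fun {h} hh v => by
        simp only [Set.mem_ofPred_eq] at hh
        rw [map_inv, Equiv.Perm.inv_eq_iff_eq, hh, Matrix.mulVec_add, mulVec_inv_mulVec, add_assoc,
          ← hh, show φ h ((φ h)⁻¹ 0) = 0 from (φ h).apply_symm_apply 0, add_zero] }
  have hQ : Q = ⊤ := S.eq_top_of_generators_mem hb fun x hx v => by
    rw [hφ x hx]
    simp [affinePerm]
  have hQ' : ∀ h v, φ h v = h.1.1 *ᵥ v + φ h 0 := fun h =>
    show h ∈ Q by rw [hQ]; trivial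
  refine ⟨S.mkCocycle (fun h => φ h 0) fun h k => ?_, fun x hx => ?_⟩
  · rw [map_mul, Equiv.Perm.mul_apply, hQ' h (φ k 0), add_comm]
  · show φ _ 0 = f x
    rw [hφ x hx]
    simp [affinePerm]

/-- Mathlib's coboundaries are `h ↦ h v - v`, hence the change of sign. -/
theorem cls_eq_zero_iff (u : S.Z1) : S.cls u = 0 ↔ ∃ v, u = S.coboundary v := by
  rw [HyperbolicSurface.cls]
  refine (groupCohomology.H1π_eq_zero_iff u).trans ?_
  constructor
  · rintro ⟨v, hv⟩
    have key : ∀ (h : S.G) (w : Fin 3 → ℝ), h.1.1 *ᵥ w - w = -w - h.1.1 *ᵥ (-w) := fun h w => by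
      rw [Matrix.mulVec_neg]; abel
    exact ⟨-v, S.val_ext fun h => (congrFun hv h).symm.trans (key h v)⟩
  · rintro ⟨v, rfl⟩
    refine ⟨-v, funext fun h => ?_⟩
    show h.1.1 *ᵥ (-v) - (-v) = v - h.1.1 *ᵥ v
    rw [Matrix.mulVec_neg]; abel

theorem cls_surjective : Function.Surjective S.cls := by
  intro x
  induction x using groupCohomology.H1_induction_on with
  | h x => exact ⟨x, rfl⟩

/-! ### Neutral vectors of the Fuchsian group -/

theorem mem_SO21 (h : S.G) : h.1 ∈ SO21 := S.subset_SO21 h.2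

theorem isHyperbolic {h : S.G} (hh : h ≠ 1) : IsHyperbolic h.1 :=
  S.hyperbolic h.1 h.2 fun e => hh (Subtype.ext e)

theorem lorentz_mulVec (h : S.G) (x y : Fin 3 → ℝ) :
    lorentz (h.1.1 *ᵥ x) (h.1.1 *ᵥ y) = lorentz x y := (S.mem_SO21 h).1 x y

theorem lorentz_mulVec_left (h : S.G) (x y : Fin 3 → ℝ) :
    lorentz (h.1.1 *ᵥ x) y = lorentz x (h⁻¹.1.1 *ᵥ y) := by
  rw [← S.lorentz_mulVec h x, S.mulVec_inv_mulVec]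

theorem mulVec_neutralVector (h : S.G) :
    h.1.1 *ᵥ neutralVector h.1 = neutralVector h.1 := by
  by_cases hh : h = 1
  · rw [hh, mulVec_one]
  · obtain ⟨_, _, hX⟩ := isNullFrame_neutralVector (S.mem_SO21 h) (S.isHyperbolic hh)
    exact hX.2.2.2.1

theorem neutralVector_ne_zero {h : S.G} (hh : h ≠ 1) : neutralVector h.1 ≠ 0 := by
  obtain ⟨_, _, hX⟩ := isNullFrame_neutralVector (S.mem_SO21 h) (S.isHyperbolic hh)
  exact hX.ne_zero

theorem eq_smul_neutralVector {h : S.G} (hh : h ≠ 1) {v : Fin 3 → ℝ} (hv : h.1.1 *ᵥ v = v) :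
    ∃ α : ℝ, v = α • neutralVector h.1 := by
  obtain ⟨_, _, hX⟩ := isNullFrame_neutralVector (S.mem_SO21 h) (S.isHyperbolic hh)
  exact hX.eq_smul_of_fixed (S.mem_SO21 h) hv

/-- Elements that do not commute have no common nonzero fixed vector. -/
theorem eq_zero_of_fixed {h k : S.G} (hk : ¬ Commute h k) {v : Fin 3 → ℝ}
    (hv : h.1.1 *ᵥ v = v) (kv : k.1.1 *ᵥ v = v) : v = 0 := by
  have h1 : h ≠ 1 := by rintro rfl; exact hk (Commute.one_left k)
  have k1 : k ≠ 1 := by rintro rfl; exact hk (Commute.one_right h)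
  obtain ⟨_, _, hX⟩ := isNullFrame_neutralVector (S.mem_SO21 h) (S.isHyperbolic h1)
  obtain ⟨_, _, kX⟩ := isNullFrame_neutralVector (S.mem_SO21 k) (S.isHyperbolic k1)
  obtain ⟨α, rfl⟩ := hX.eq_smul_of_fixed (S.mem_SO21 h) hv
  by_cases hα : α = 0
  · rw [hα, zero_smul]
  · rw [Matrix.mulVec_smul] at kv
    exact (hk (Subtype.ext (hX.commute_of_fixed (S.mem_SO21 h) (S.mem_SO21 k) kX
      (smul_right_injective _ hα kv)))).elim

theorem lorentz_sub_fixed (h : S.G) {v : Fin 3 → ℝ} (hv : h.1.1 *ᵥ v = v) (x : Fin 3 → ℝ) :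
    lorentz (h.1.1 *ᵥ x - x) v = 0 := by
  rw [lorentz_sub_left, S.lorentz_mulVec_left, S.inv_mulVec_of_fixed hv, sub_self]

/-- A cocycle has zero Margulis invariant at `h` only if it is a coboundary on `⟨h⟩`. -/
theorem exists_mem_eqLocus_of_Mar_eq_zero {u : S.Z1} {h : S.G} (hu : S.Mar u h = 0) :
    ∃ v, h ∈ S.eqLocus u (S.coboundary v) := by
  by_cases hh : h = 1
  · exact ⟨0, hh ▸ Subgroup.one_mem _⟩
  · obtain ⟨_, _, hX⟩ := isNullFrame_neutralVector (S.mem_SO21 h) (S.isHyperbolic hh)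
    obtain ⟨v, hv⟩ := hX.exists_eq_sub_of_orthogonal (S.mem_SO21 h) hu
    exact ⟨v, hv⟩

/-- This is what turns the passage across a dividing curve into a multiple of its neutral vector. -/
theorem sub_fixed_of_mem_eqLocus {u : S.Z1} {h : S.G} {v w : Fin 3 → ℝ}
    (hv : h ∈ S.eqLocus u (S.coboundary v)) (hw : h ∈ S.eqLocus u (S.coboundary w)) :
    h.1.1 *ᵥ (v - w) = v - w := by
  have : v - h.1.1 *ᵥ v = w - h.1.1 *ᵥ w := Eq.trans (Eq.symm hv) hw
  rw [Matrix.mulVec_sub]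
  linear_combination (exp := 1) -this

theorem mem_eqLocus_add_fixed {u : S.Z1} {h : S.G} {v w : Fin 3 → ℝ}
    (hv : h ∈ S.eqLocus u (S.coboundary v)) (hw : h.1.1 *ᵥ w = w) :
    h ∈ S.eqLocus u (S.coboundary (v + w)) := by
  rw [mem_eqLocus] at *
  rw [hv, val_coboundary, val_coboundary, Matrix.mulVec_add, hw]
  abel

/-! ### Pairs of pants and once-holed tori -/

/-- The vectors representing `u` at `A` contain a line parallel to `X_A⁰`, those at `B` a line
parallel to `X_B⁰`. The lines meet once `w - a` lies in the plane spanned by the two directions, and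
this plane is the orthogonal complement of `n`. -/
theorem exists_common_of_orthogonal {u : S.Z1} {A B : S.G} (hAB : ¬ Commute A B)
    {a w n : Fin 3 → ℝ} (ha : A ∈ S.eqLocus u (S.coboundary a))
    (hw : B ∈ S.eqLocus u (S.coboundary w)) (hn : n ≠ 0)
    (hnA : lorentz n (neutralVector A.1) = 0) (hnB : lorentz n (neutralVector B.1) = 0)
    (haw : lorentz (w - a) n = 0) :
    ∃ z, A ∈ S.eqLocus u (S.coboundary z) ∧ B ∈ S.eqLocus u (S.coboundary z) := by
  have hA : A ≠ 1 := by rintro rfl; exact hAB (Commute.one_left B)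
  have hB : B ≠ 1 := by rintro rfl; exact hAB (Commute.one_right A)
  have fixA : ∀ α : ℝ, A.1.1 *ᵥ (α • neutralVector A.1) = α • neutralVector A.1 := fun α => by
    rw [Matrix.mulVec_smul, mulVec_neutralVector]
  have fixB : ∀ α : ℝ, B.1.1 *ᵥ (α • neutralVector B.1) = α • neutralVector B.1 := fun α => by
    rw [Matrix.mulVec_smul, mulVec_neutralVector]
  obtain ⟨α, β, e⟩ := exists_eq_add_smul_of_orthogonal (x := neutralVector A.1)
    (y := neutralVector B.1) hn (fun α β e => by
      have e' : α • neutralVector A.1 = (-β) • neutralVector B.1 := by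
        rw [neg_smul]; exact eq_neg_of_add_eq_zero_left e
      have h0 := S.eq_zero_of_fixed hAB (fixA α) (by rw [e']; exact fixB _)
      rw [h0, zero_add] at e
      exact ⟨(smul_eq_zero.1 h0).resolve_right (S.neutralVector_ne_zero hA),
        (smul_eq_zero.1 e).resolve_right (S.neutralVector_ne_zero hB)⟩)
    (by rw [lorentz_comm]; exact hnA) (by rw [lorentz_comm]; exact hnB) haw
  refine ⟨a + α • neutralVector A.1, S.mem_eqLocus_add_fixed ha (fixA α), ?_⟩
  have : a + α • neutralVector A.1 = w + (-β) • neutralVector B.1 := by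
    rw [neg_smul]
    linear_combination (exp := 1) -e
  rw [this]
  exact S.mem_eqLocus_add_fixed hw (fixB _)

/-- On a pair of pants a cocycle that is a coboundary on each boundary curve is a coboundary. -/
theorem exists_common_of_pants {u : S.Z1} {A B : S.G} (hAB : ¬ Commute A B)
    (hA : ∃ v, A ∈ S.eqLocus u (S.coboundary v)) (hB : ∃ v, B ∈ S.eqLocus u (S.coboundary v))
    (hC : ∃ v, A * B ∈ S.eqLocus u (S.coboundary v)) :
    ∃ z, A ∈ S.eqLocus u (S.coboundary z) ∧ B ∈ S.eqLocus u (S.coboundary z) := by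
  obtain ⟨a, ha⟩ := hA
  obtain ⟨w, hw⟩ := hB
  obtain ⟨e, he⟩ := hC
  have hAB1 : A * B ≠ 1 := fun h => hAB (by
    rw [eq_inv_of_mul_eq_one_right h]; exact (Commute.refl A).inv_right)
  have hX := S.mulVec_neutralVector (A * B)
  have hX0 := S.neutralVector_ne_zero hAB1
  set X := neutralVector (A * B).1
  have hBX : A⁻¹.1.1 *ᵥ X = B.1.1 *ᵥ X := by
    conv_lhs => rw [← hX, mulVec_mul, inv_mulVec_mulVec]
  -- Since `AB` fixes `X`, also `n = A⁻¹X - X`, so `n` is orthogonal to both neutral vectors. The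
  -- cocycle identity turns the condition at `AB` into `B(w - a, n) = 0`.
  refine S.exists_common_of_orthogonal hAB ha hw (n := B.1.1 *ᵥ X - X) ?_ ?_ ?_ ?_
  · intro h
    have hB : B.1.1 *ᵥ X = X := sub_eq_zero.1 h
    refine hX0 (S.eq_zero_of_fixed hAB ?_ hB)
    rw [mulVec_mul, hB] at hX
    exact hX
  · rw [← hBX]
    exact S.lorentz_sub_fixed A⁻¹ (S.inv_mulVec_of_fixed (S.mulVec_neutralVector A)) X
  · exact S.lorentz_sub_fixed B (S.mulVec_neutralVector B) X
  · rw [mem_eqLocus, val_mul, S.mem_eqLocus.1 ha, S.mem_eqLocus.1 hw] at he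
    simp only [val_coboundary] at he
    have h1 : lorentz (e - (A * B).1.1 *ᵥ e) X = 0 := by
      have := S.lorentz_sub_fixed (A * B) hX e
      rw [lorentz_sub_left] at this ⊢
      linarith
    have h2 : lorentz (A.1.1 *ᵥ (B.1.1 *ᵥ w)) X = lorentz w X := by
      rw [← mulVec_mul, lorentz_mulVec_left, S.inv_mulVec_of_fixed hX]
    rw [← he, Matrix.mulVec_sub, lorentz_add_left, lorentz_sub_left, lorentz_sub_left, h2,
      S.lorentz_mulVec_left A a, S.lorentz_mulVec_left A w, hBX] at h1
    rw [lorentz_sub_left, lorentz_sub_right, lorentz_sub_right]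
    linarith

/-- On a once-holed torus whose generators have axes that do not cross at a right angle, a cocycle
that is a coboundary on both generators and on the boundary is a coboundary. -/
theorem exists_common_of_torus {u : S.Z1} {A B : S.G} (hAB : ¬ Commute A B)
    (hAC : ¬ Commute A (A * B * A⁻¹ * B⁻¹))
    (hang : lorentz (neutralVector A.1) (neutralVector B.1) ≠ 0)
    (hA : ∃ v, A ∈ S.eqLocus u (S.coboundary v)) (hB : ∃ v, B ∈ S.eqLocus u (S.coboundary v))
    (hC : ∃ v, A * B * A⁻¹ * B⁻¹ ∈ S.eqLocus u (S.coboundary v)) :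
    ∃ z, A ∈ S.eqLocus u (S.coboundary z) ∧ B ∈ S.eqLocus u (S.coboundary z) := by
  obtain ⟨a, ha⟩ := hA
  obtain ⟨w, hw⟩ := hB
  obtain ⟨e, he⟩ := hC
  have hB1 : B ≠ 1 := by rintro rfl; exact hAB (Commute.one_right A)
  have hC1 : A * B * A⁻¹ * B⁻¹ ≠ 1 := fun h => hAC (h ▸ Commute.one_right A)
  have hX := S.mulVec_neutralVector (A * B * A⁻¹ * B⁻¹)
  have hX0 := S.neutralVector_ne_zero hC1
  set X := neutralVector (A * B * A⁻¹ * B⁻¹).1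
  obtain ⟨p, hp⟩ : ∃ p, p = A⁻¹.1.1 *ᵥ X := ⟨_, rfl⟩
  obtain ⟨q, hq⟩ : ∃ q, q = B⁻¹.1.1 *ᵥ X := ⟨_, rfl⟩
  obtain ⟨r, hr⟩ : ∃ r, r = B⁻¹.1.1 *ᵥ p := ⟨_, rfl⟩
  have hrq : r = A⁻¹.1.1 *ᵥ q := by
    rw [hr, hp, hq]
    conv_lhs => rw [← hX]
    simp only [mulVec_mul, inv_mulVec_mulVec]
  have hArq : A.1.1 *ᵥ r = q := by rw [hrq, mulVec_inv_mulVec]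
  have fixA := S.inv_mulVec_of_fixed (S.mulVec_neutralVector A)
  have fixB := S.inv_mulVec_of_fixed (S.mulVec_neutralVector B)
  have hpA : lorentz (p - X) (neutralVector A.1) = 0 := by
    rw [hp]; exact S.lorentz_sub_fixed A⁻¹ fixA X
  -- Here `r = A⁻¹q = B⁻¹p`, because the commutator fixes `X`. Grouping `n` as `(A⁻¹-1)(X-q)` or as
  -- `(B⁻¹-1)(X-p)` shows both orthogonalities.
  refine S.exists_common_of_orthogonal hAB ha hw (n := p - X - (r - q)) ?_ ?_ ?_ ?_
  -- If `n = 0`, then `p - X` is fixed by `B`, hence a multiple of `X_B⁰`; being orthogonal to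
  -- `X_A⁰`, it vanishes by the angle condition. Then `A` and the commutator both fix `X`.
  · intro h
    have hfix : B.1.1 *ᵥ (p - X) = p - X := by
      have e1 : p - X = B⁻¹.1.1 *ᵥ (p - X) := by
        rw [Matrix.mulVec_sub, ← hr, ← hq]
        exact sub_eq_zero.1 h
      conv_lhs => rw [e1, mulVec_inv_mulVec]
    obtain ⟨l, hl⟩ := S.eq_smul_neutralVector hB1 hfix
    rw [hl, lorentz_smul_left, lorentz_comm] at hpA
    rw [(mul_eq_zero.1 hpA).resolve_right hang, zero_smul, sub_eq_zero] at hl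
    refine hX0 (S.eq_zero_of_fixed hAC ?_ hX)
    conv_lhs => rw [← hl, hp, mulVec_inv_mulVec]
  · rw [lorentz_sub_left, hpA, hrq, S.lorentz_sub_fixed A⁻¹ fixA, sub_zero]
  · rw [show p - X - (r - q) = (q - X) - (r - p) by abel, lorentz_sub_left, hr, hq,
      S.lorentz_sub_fixed B⁻¹ fixB, S.lorentz_sub_fixed B⁻¹ fixB, sub_zero]
  · have ha' := Subgroup.inv_mem _ ha
    have hw' := Subgroup.inv_mem _ hw
    have h1 : lorentz (e - (A * B * A⁻¹ * B⁻¹).1.1 *ᵥ e) X = 0 := by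
      have := S.lorentz_sub_fixed (A * B * A⁻¹ * B⁻¹) hX e
      rw [lorentz_sub_left] at this ⊢
      linarith
    rw [mem_eqLocus, val_mul, val_mul, val_mul, S.mem_eqLocus.1 ha, S.mem_eqLocus.1 hw,
      S.mem_eqLocus.1 ha', S.mem_eqLocus.1 hw'] at he
    simp only [val_coboundary] at he
    have k2 : ∀ y, lorentz (A.1.1 *ᵥ y) X = lorentz y p := fun y => by
      rw [lorentz_mulVec_left, hp]
    have k3 : ∀ y, lorentz (A.1.1 *ᵥ (B.1.1 *ᵥ y)) X = lorentz y r := fun y => by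
      rw [k2, lorentz_mulVec_left, hr]
    have k4 : ∀ y, lorentz (A.1.1 *ᵥ (B.1.1 *ᵥ (A⁻¹.1.1 *ᵥ y))) X = lorentz y q := fun y => by
      rw [k3, lorentz_mulVec_left, inv_inv, hArq]
    have k5 : ∀ y, lorentz (A.1.1 *ᵥ (B.1.1 *ᵥ (A⁻¹.1.1 *ᵥ (B⁻¹.1.1 *ᵥ y)))) X = lorentz y X :=
      fun y => by rw [k4, lorentz_mulVec_left, inv_inv, hq, mulVec_inv_mulVec]
    rw [← he] at h1
    simp only [mulVec_mul, Matrix.mulVec_sub, lorentz_add_left, lorentz_sub_left, k5, k4, k3, k2]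
      at h1
    simp only [lorentz_sub_left, lorentz_sub_right]
    linarith

/-! ### Noncommuting elements -/

/-- Handle loops can only go to commutators; sending boundary loops to commutators too allows both
kinds to be treated alike. -/
theorem exists_hom_loop (hb : 0 < b) {H : Type} [Group H] (x y : ℕ → H) :
    ∃ φ : S.G →* H, (∀ i, 1 ≤ i → i < b + g → φ (S.loop i) = x i * y i * (x i)⁻¹ * (y i)⁻¹) ∧
      ∀ j : Fin g, φ (S.lon j) = x (b + j) ∧ φ (S.mer j) = y (b + j) := by
  obtain ⟨φ, hφ⟩ := S.exists_hom hb fun s => match s with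
    | .bdry i => x i * y i * (x i)⁻¹ * (y i)⁻¹
    | .lon j => x (b + j)
    | .mer j => y (b + j)
  have hl : ∀ j : Fin g, φ (S.lon j) = x (b + j) ∧ φ (S.mer j) = y (b + j) :=
    fun j => ⟨hφ (.lon j) (by simp), hφ (.mer j) (by simp)⟩
  refine ⟨φ, fun i hi hi' => ?_, hl⟩
  rcases lt_or_ge i b with h | h
  · rw [show S.loop i = _ from S.loop_bdry ⟨i, h⟩]
    refine hφ _ fun e => ?_
    have := congrArg Fin.val (SurfaceGen.bdry.inj e)
    simp only at this
    omega
  · obtain ⟨j, rfl⟩ := Nat.exists_eq_add_of_le h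
    rw [show S.loop (b + j) = _ from S.loop_handle ⟨j, by omega⟩]
    simp only [map_mul, map_inv, hl]

/-- Degree `4` is needed: commutators in `S₃` lie in the abelian group `A₃`. -/
theorem exists_noncommuting_commutators : ∃ p q r s : Equiv.Perm (Fin 4),
    ¬ Commute (p * q * p⁻¹ * q⁻¹) (r * s * r⁻¹ * s⁻¹) :=
  ⟨Equiv.swap 0 1, Equiv.swap 1 2, Equiv.swap 1 2, Equiv.swap 2 3,
    by unfold Commute SemiconjBy; decide⟩

/-- Map loops `k+1` and `k+2` to noncommuting commutators and all later ones to `1`. The relation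
sends `head (k+3)` to `1`, so `head (k+2)` goes to the inverse of the image of loop `k+2`, which
does not commute with that of loop `k+1`. -/
theorem not_commute_head_loop (hb : 0 < b) {k : ℕ} (hk : k + 3 ≤ b + g) :
    ¬ Commute (S.head (k + 1)) (S.loop (k + 1)) := by
  obtain ⟨p, q, r, s, h⟩ := exists_noncommuting_commutators
  obtain ⟨φ, hφ, -⟩ := S.exists_hom_loop hb
    (fun i => if i = k + 1 then p else if i = k + 2 then r else 1)
    (fun i => if i = k + 1 then q else if i = k + 2 then s else 1)
  intro hc
  have h3 : S.head (k + 3) ∈ φ.ker := S.head_mem_of_tail hk fun i hi hi' => by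
    rw [MonoidHom.mem_ker, hφ i (by omega) hi', if_neg (by omega), if_neg (by omega),
      if_neg (by omega), if_neg (by omega)]
    simp
  rw [MonoidHom.mem_ker, head_succ, map_mul, hφ (k + 2) (by omega) (by omega)] at h3
  have h2 := (hc.mul_left (Commute.refl _)).map φ
  rw [← head_succ, eq_inv_of_mul_eq_one_left h3, hφ (k + 1) (by omega) (by omega)] at h2
  have h2' := h2.inv_left
  simp only [inv_inv] at h2'
  simp at h2'
  exact h h2'.symm

theorem not_commute_lon_mer (hb : 0 < b) (j : Fin g) :
    ¬ Commute (S.lon j) (S.mer j) ∧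
      ¬ Commute (S.lon j) (S.lon j * S.mer j * (S.lon j)⁻¹ * (S.mer j)⁻¹) := by
  obtain ⟨φ, -, hφ⟩ := S.exists_hom_loop hb
    (fun _ => (Equiv.swap 0 1 : Equiv.Perm (Fin 3))) (fun _ => Equiv.swap 1 2)
  constructor <;> intro h <;> have := h.map φ <;>
    simp only [map_mul, map_inv, (hφ j).1, (hφ j).2] at this <;> revert this <;>
    unfold Commute SemiconjBy <;> decide

/-! ### Affine twist cocycles -/

theorem bdry_zero_not_onSecondSide (hb : 0 < b) (c : DividingCurve g b) :
    ¬ c.OnSecondSide (.bdry ⟨0, hb⟩) := by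
  cases c <;> simp only [DividingCurve.OnSecondSide, SurfaceGen.pos] <;> omega

theorem val_generator_of_isAffineTwist {c : DividingCurve g b} {u : S.Z1}
    (hu : S.IsAffineTwist c u) (x : SurfaceGen g b) [Decidable (c.OnSecondSide x)] :
    S.val u (S.elt (FreeGroup.of x)) =
      S.val (S.coboundary (if c.OnSecondSide x then neutralVector (S.div c).1 else 0))
        (S.elt (FreeGroup.of x)) := by
  split_ifs with h
  · exact hu.2 _ (Subgroup.subset_closure ⟨x, h, rfl⟩)
  · rw [hu.1 _ (Subgroup.subset_closure ⟨x, h, rfl⟩), map_zero]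
    rfl

/-- Both conditions prescribe the cocycle on the free generators, which gives uniqueness. For
existence only the value at the first boundary loop needs checking. -/
theorem existsUnique_isAffineTwist (hb : 0 < b) (c : DividingCurve g b) :
    ∃! u : S.Z1, S.IsAffineTwist c u := by
  classical
  have hX := S.mulVec_neutralVector (S.div c)
  set X := neutralVector (S.div c).1 with hXdef
  obtain ⟨u, hu⟩ := S.exists_cocycle hb fun x =>
    S.val (S.coboundary (if c.OnSecondSide x then X else 0)) (S.elt (FreeGroup.of x))
  have hK : ∀ x, x ≠ .bdry ⟨0, hb⟩ → ¬ c.OnSecondSide x → S.elt (FreeGroup.of x) ∈ S.eqLocus u 0 :=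
    fun x hx hc => by
      rw [mem_eqLocus, hu x hx, if_neg hc, map_zero]
  have hM : ∀ x, c.OnSecondSide x → S.elt (FreeGroup.of x) ∈ S.eqLocus u (S.coboundary X) :=
    fun x hc => by
      rw [mem_eqLocus, hu x, if_pos hc]
      rintro rfl
      exact bdry_zero_not_onSecondSide hb c hc
  -- The two prescriptions agree on elements fixing `X`, in particular on the dividing curve. This
  -- carries the relation from the second side to the first.
  have hMK : ∀ h, h ∈ S.eqLocus u (S.coboundary X) → h.1.1 *ᵥ X = X → h ∈ S.eqLocus u 0 := by
    intro h hh hf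
    rw [mem_eqLocus] at *
    rw [hh, val_coboundary, hf, sub_self]
    rfl
  have pos_ne : ∀ x : SurfaceGen g b, 1 ≤ x.pos → x ≠ .bdry ⟨0, hb⟩ := by
    rintro _ h rfl
    simp [SurfaceGen.pos] at h
  have h0 : S.head 1 ∈ S.eqLocus u 0 := by
    cases c with
    | handle j hj =>
      refine S.head_mem_of_tail (by omega) fun i hi hi' => ?_
      by_cases hij : i = b + j
      · refine hMK _ (S.loop_mem hi' fun x hx => hM x (hx.trans hij)) ?_
        rw [hij, ← S.div_handle j hj]
        exact hX
      · exact S.loop_mem hi' fun x hx => hK x (pos_ne x (hx ▸ hi)) fun h => hij (hx.symm.trans h)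
    | planar k =>
      have hk := k.2
      refine S.head_mem_of_head_mem (m := k + 2) (by omega) ?_ fun i hi hi' =>
        S.loop_mem (by omega) fun x hx => hK x (pos_ne x (hx ▸ hi)) fun h => ?_
      · refine hMK _ (S.head_mem_of_tail (by omega) fun i hi hi' =>
          S.loop_mem hi' fun x hx => hM x (hi.trans hx.ge)) ?_
        rw [← inv_inv (S.head _), ← div_planar]
        exact S.inv_mulVec_of_fixed hX
      · simp only [DividingCurve.OnSecondSide] at h
        omega
  rw [head_one, show S.loop 0 = _ from S.loop_bdry ⟨0, hb⟩] at h0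
  refine ⟨u, ⟨?_, ?_⟩, fun v hv => S.eq_of_eq_generators hb fun x hx => ?_⟩
  · refine (show S.firstSide c ≤ S.eqLocus u 0 from (Subgroup.closure_le _).2 ?_)
    rintro _ ⟨x, hx, rfl⟩
    by_cases hx0 : x = .bdry ⟨0, hb⟩
    · rw [hx0]; exact h0
    · exact hK x hx0 hx
  · refine (show S.secondSide c ≤ S.eqLocus u (S.coboundary X) from (Subgroup.closure_le _).2 ?_)
    rintro _ ⟨x, hx, rfl⟩
    exact hM x hx
  · rw [S.val_generator_of_isAffineTwist hv, hu x hx]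

end HyperbolicSurface

/-! ### Counting curves and generators. -/

section Curves

variable {g b : ℕ}

/-- `DividingCurve g b` as a sum of finite index types. -/
def DividingCurve.equivSum (h : 3 ≤ g + b) : DividingCurve g b ≃ Fin g ⊕ Fin (g + b - 3) where
  toFun
    | .handle j _ => .inl j
    | .planar k => .inr k
  invFun
    | .inl j => .handle j h
    | .inr k => .planar k
  left_inv c := by cases c <;> rfl
  right_inv c := by cases c <;> rfl

theorem DividingCurve.sum_eq {M : Type*} [AddCommMonoid M] (h : 3 ≤ g + b)
    (f : DividingCurve g b → M) : ∑ c, f c = ∑ j, f (.handle j h) + ∑ k, f (.planar k) := by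
  rw [← (DividingCurve.equivSum h).symm.sum_comp, Fintype.sum_sum_type]
  rfl

theorem DividingCurve.card (h : 3 ≤ g + b) :
    Fintype.card (DividingCurve g b) = g + (g + b - 3) := by
  rw [Fintype.card_congr (DividingCurve.equivSum h)]
  simp

theorem DividingCurve.isEmpty (h : g + b ≤ 2) : IsEmpty (DividingCurve g b) :=
  ⟨fun c => by
    cases c with
    | handle j h' => omega
    | planar k => have := k.2; omega⟩

/-- `CoordCurve g b` as a sum of finite index types. -/
def CoordCurve.equivSum : CoordCurve g b ≃ (Fin b ⊕ DividingCurve g b) ⊕ (Fin g ⊕ Fin g) where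
  toFun
    | .bdry i => .inl (.inl i)
    | .div c => .inl (.inr c)
    | .lon j => .inr (.inl j)
    | .mer j => .inr (.inr j)
  invFun
    | .inl (.inl i) => .bdry i
    | .inl (.inr c) => .div c
    | .inr (.inl j) => .lon j
    | .inr (.inr j) => .mer j
  left_inv c := by cases c <;> rfl
  right_inv c := by rcases c with ((_ | _) | (_ | _)) <;> rfl

noncomputable instance : Fintype (CoordCurve g b) := Fintype.ofEquiv _ CoordCurve.equivSum.symm

theorem CoordCurve.card :
    Fintype.card (CoordCurve g b) = b + Fintype.card (DividingCurve g b) + (g + g) := by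
  rw [Fintype.card_congr CoordCurve.equivSum]
  simp

theorem CoordCurve.card_add_card (hb : 0 < b) (hgb : 2 < 2 * g + b) :
    Fintype.card (CoordCurve g b) + Fintype.card (DividingCurve g b) + 6 = 6 * g + 3 * b := by
  rw [CoordCurve.card]
  by_cases h : 3 ≤ g + b
  · rw [DividingCurve.card h]; omega
  · have := DividingCurve.isEmpty (g := g) (b := b) (by omega)
    rw [Fintype.card_eq_zero]; omega

/-- `SurfaceGen g b` as a sum of finite index types. -/
def SurfaceGen.equivSum : SurfaceGen g b ≃ Fin b ⊕ (Fin g ⊕ Fin g) where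
  toFun
    | .bdry i => .inl i
    | .lon j => .inr (.inl j)
    | .mer j => .inr (.inr j)
  invFun
    | .inl i => .bdry i
    | .inr (.inl j) => .lon j
    | .inr (.inr j) => .mer j
  left_inv c := by cases c <;> rfl
  right_inv c := by rcases c with (_ | (_ | _)) <;> rfl

noncomputable instance : Fintype (SurfaceGen g b) := Fintype.ofEquiv _ SurfaceGen.equivSum.symm

theorem SurfaceGen.card : Fintype.card (SurfaceGen g b) = b + (g + g) := by
  rw [Fintype.card_congr SurfaceGen.equivSum]
  simp

end Curves

namespace HyperbolicSurface

variable {g b : ℕ} (S : HyperbolicSurface g b)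

/-! ### Dimensions -/

/-- A vector with zero coboundary is fixed by all of `G`. A noncommuting pair comes from a handle,
or from two boundary loops if `g = 0`. -/
theorem coboundary_injective (hb : 0 < b) (hgb : 2 < 2 * g + b) :
    Function.Injective S.coboundary := by
  rw [injective_iff_map_eq_zero]
  intro v hv
  have hfix : ∀ h : S.G, h.1.1 *ᵥ v = v := fun h => by
    have : v - h.1.1 *ᵥ v = 0 := by rw [← val_coboundary, hv]; rfl
    exact (sub_eq_zero.1 this).symm
  rcases Nat.eq_zero_or_pos g with hg | hg
  · exact S.eq_zero_of_fixed (S.not_commute_head_loop hb (k := 0) (by omega)) (hfix _) (hfix _)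
  · exact S.eq_zero_of_fixed (S.not_commute_lon_mer hb ⟨0, hg⟩).1 (hfix _) (hfix _)

/-- Evaluation of cocycles at the generators other than the first boundary loop. -/
noncomputable def evalEquiv (hb : 0 < b) :
    S.Z1 ≃ₗ[ℝ] ({x : SurfaceGen g b // x ≠ .bdry ⟨0, hb⟩} → Fin 3 → ℝ) :=
  LinearEquiv.ofBijective
    { toFun := fun u x => S.val u (S.elt (FreeGroup.of x.1))
      map_add' := fun _ _ => rfl
      map_smul' := fun _ _ => rfl }
    ⟨fun _ _ h => S.eq_of_eq_generators hb fun x hx => congrFun h ⟨x, hx⟩, fun f => by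
      classical
      obtain ⟨u, hu⟩ := S.exists_cocycle hb fun x => if hx : x ≠ .bdry ⟨0, hb⟩ then f ⟨x, hx⟩ else 0
      exact ⟨u, funext fun x => (hu x.1 x.2).trans (dif_pos x.2)⟩⟩

theorem finite_Z1 (hb : 0 < b) : Module.Finite ℝ S.Z1 :=
  Module.Finite.equiv (S.evalEquiv hb).symm

theorem finrank_Z1 (hb : 0 < b) : Module.finrank ℝ S.Z1 + 3 = 6 * g + 3 * b := by
  classical
  rw [(S.evalEquiv hb).finrank_eq, Module.finrank_pi_fintype]
  simp only [Module.finrank_fin_fun, Finset.sum_const, Finset.card_univ, smul_eq_mul]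
  rw [Fintype.card_subtype_compl, Fintype.card_subtype_eq, SurfaceGen.card]
  omega

theorem finite_H1 (hb : 0 < b) : Module.Finite ℝ S.H1 :=
  have := S.finite_Z1 hb
  Module.Finite.of_surjective S.cls S.cls_surjective

theorem finrank_H1 (hb : 0 < b) (hgb : 2 < 2 * g + b) :
    Module.finrank ℝ S.H1 + 6 = 6 * g + 3 * b := by
  have := S.finite_Z1 hb
  have h := S.cls.finrank_range_add_finrank_ker
  have hker : LinearMap.ker S.cls = LinearMap.range S.coboundary := by
    ext u
    rw [LinearMap.mem_ker, cls_eq_zero_iff, LinearMap.mem_range]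
    simp only [eq_comm]
  rw [LinearMap.range_eq_top.2 S.cls_surjective, finrank_top, hker,
    LinearMap.finrank_range_of_inj (S.coboundary_injective hb hgb), Module.finrank_fin_fun] at h
  have := S.finrank_Z1 hb
  omega

/-! ### Cocycles with vanishing Margulis invariants -/

section Kernel

variable {u : S.Z1}

theorem lorentz_neutralVector_lon_mer_ne_zero (hb : 0 < b)
    (hangle : ∀ (j : Fin g) (θ : ℝ), IsAxisAngle (S.lon j).1 (S.mer j).1 θ → θ ≠ Real.pi / 2)
    (j : Fin g) : lorentz (neutralVector (S.lon j).1) (neutralVector (S.mer j).1) ≠ 0 := by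
  intro h0
  have hc := (S.not_commute_lon_mer hb j).1
  have h1 : S.lon j ≠ 1 := fun h => hc (h ▸ Commute.one_left _)
  have h2 : S.mer j ≠ 1 := fun h => hc (h ▸ Commute.one_right _)
  exact hangle j _ (isAxisAngle_pi_div_two (S.mem_SO21 _) (S.isHyperbolic h1) (S.mem_SO21 _)
    (S.isHyperbolic h2) h0) rfl

/-- The condition at the boundary loop is a hypothesis because this loop is a dividing curve if `g +
b ≥ 3` but the inverse of the hole if `g = b = 1`. -/
theorem exists_common_handle (hb : 0 < b)
    (hangle : ∀ (j : Fin g) (θ : ℝ), IsAxisAngle (S.lon j).1 (S.mer j).1 θ → θ ≠ Real.pi / 2)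
    (hu : ∀ x, S.Mar u (S.curve x) = 0) (j : Fin g)
    (hj : ∃ v, S.loop (b + j) ∈ S.eqLocus u (S.coboundary v)) :
    ∃ y, S.lon j ∈ S.eqLocus u (S.coboundary y) ∧ S.mer j ∈ S.eqLocus u (S.coboundary y) := by
  have hc := S.not_commute_lon_mer hb j
  refine S.exists_common_of_torus hc.1 hc.2
    (S.lorentz_neutralVector_lon_mer_ne_zero hb hangle j)
    (S.exists_mem_eqLocus_of_Mar_eq_zero (hu (.lon j)))
    (S.exists_mem_eqLocus_of_Mar_eq_zero (hu (.mer j))) ?_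
  rwa [← loop_handle]

theorem exists_mem_eqLocus_loop (h3 : 3 ≤ g + b) (hu : ∀ x, S.Mar u (S.curve x) = 0) {i : ℕ}
    (hi : i < b + g) : ∃ v, S.loop i ∈ S.eqLocus u (S.coboundary v) := by
  rcases lt_or_ge i b with h | h
  · rw [show S.loop i = _ from S.loop_bdry ⟨i, h⟩]
    exact S.exists_mem_eqLocus_of_Mar_eq_zero (hu (.bdry ⟨i, h⟩))
  · obtain ⟨j, rfl⟩ := Nat.exists_eq_add_of_le h
    rw [show S.loop (b + j) = _ from (S.div_handle ⟨j, by omega⟩ h3).symm]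
    exact S.exists_mem_eqLocus_of_Mar_eq_zero (hu (.div (.handle ⟨j, by omega⟩ h3)))

theorem head_pred_last (h : 0 < b + g) : S.head (b + g - 1) = (S.loop (b + g - 1))⁻¹ := by
  apply eq_inv_of_mul_eq_one_left
  rw [← head_succ, Nat.sub_add_cancel h, head_last]

/-- Up to inversion, each such partial product is the first loop, the last loop or a planar dividing
curve. -/
theorem exists_mem_eqLocus_head (h3 : 3 ≤ g + b) (hu : ∀ x, S.Mar u (S.curve x) = 0) {k : ℕ}
    (hk : k + 1 < b + g) : ∃ v, S.head (k + 1) ∈ S.eqLocus u (S.coboundary v) := by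
  rcases Nat.eq_zero_or_pos k with rfl | hk0
  · rw [zero_add, head_one]
    exact S.exists_mem_eqLocus_loop h3 hu (by omega)
  by_cases hlast : k + 1 = b + g - 1
  · obtain ⟨v, hv⟩ := S.exists_mem_eqLocus_loop h3 hu (show b + g - 1 < b + g by omega)
    exact ⟨v, by rw [hlast, S.head_pred_last (by omega)]; exact Subgroup.inv_mem _ hv⟩
  · obtain ⟨v, hv⟩ := S.exists_mem_eqLocus_of_Mar_eq_zero
      (hu (.div (.planar ⟨k - 1, by omega⟩)))
    refine ⟨v, ?_⟩
    have e : S.head (k + 1) = (S.div (.planar ⟨k - 1, by omega⟩))⁻¹ := by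
      rw [div_planar, inv_inv]
      congr 1
      simp only
      omega
    rw [e]
    exact Subgroup.inv_mem _ hv

theorem exists_common_pants (hb : 0 < b) (h3 : 3 ≤ g + b) (hu : ∀ x, S.Mar u (S.curve x) = 0)
    {k : ℕ} (hk : k + 3 ≤ b + g) :
    ∃ z, S.head (k + 1) ∈ S.eqLocus u (S.coboundary z) ∧
      S.loop (k + 1) ∈ S.eqLocus u (S.coboundary z) := by
  refine S.exists_common_of_pants (S.not_commute_head_loop hb hk)
    (S.exists_mem_eqLocus_head h3 hu (by omega)) (S.exists_mem_eqLocus_loop h3 hu (by omega)) ?_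
  rw [← head_succ]
  exact S.exists_mem_eqLocus_head h3 hu (by omega)

/-- The planar loops carry the cocycle as coboundaries of vectors that differ by multiples of the
neutral vectors of the planar dividing curves. -/
theorem exists_planar_parameters (hb : 0 < b) (h3 : 3 ≤ g + b)
    (hu : ∀ x, S.Mar u (S.curve x) = 0) :
    ∃ (z : Fin 3 → ℝ) (t : Fin (g + b - 3) → ℝ), ∀ i, 1 ≤ i → i < b + g →
      S.loop i ∈ S.eqLocus u (S.coboundary
        (z + ∑ k : Fin (g + b - 3),
          if (k : ℕ) + 2 ≤ i then t k • neutralVector (S.div (.planar k)).1 else 0)) := by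
  have hp : ∀ k, ∃ z, k + 3 ≤ b + g → S.head (k + 1) ∈ S.eqLocus u (S.coboundary z) ∧
      S.loop (k + 1) ∈ S.eqLocus u (S.coboundary z) := fun k => by
    by_cases hk : k + 3 ≤ b + g
    · obtain ⟨z, hz⟩ := S.exists_common_pants hb h3 hu hk
      exact ⟨z, fun _ => hz⟩
    -- A dummy value beyond the last pair of pants.
    · exact ⟨0, fun h => (hk h).elim⟩
  choose z hz using hp
  -- Consecutive pairs of pants share the curve `head (k+2)`.
  have ht : ∀ k : Fin (g + b - 3), ∃ t : ℝ,
      z (k + 1) - z k = t • neutralVector (S.div (.planar k)).1 := fun k => by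
    have hk := k.2
    have hne : S.head (k + 2) ≠ 1 := fun h =>
      S.not_commute_head_loop hb (k := k + 1) (by omega) (by rw [h]; exact Commute.one_left _)
    refine S.eq_smul_neutralVector (by rw [div_planar]; exact inv_ne_one.2 hne) ?_
    rw [div_planar]
    refine S.inv_mulVec_of_fixed (S.sub_fixed_of_mem_eqLocus (hz (k + 1) (by omega)).1 ?_)
    have := hz k (by omega)
    rw [show (k : ℕ) + 2 = k + 1 + 1 from rfl, head_succ]
    exact Subgroup.mul_mem _ this.1 this.2
  choose t ht using ht
  refine ⟨z 0, t, ?_⟩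
  set Z : ℕ → Fin 3 → ℝ := fun i => z 0 + ∑ k : Fin (g + b - 3),
    if (k : ℕ) + 2 ≤ i then t k • neutralVector (S.div (.planar k)).1 else 0 with hZ
  have hzZ : ∀ k, k + 3 ≤ b + g → z k = Z (k + 1) := by
    intro k
    induction k with
    | zero => intro _; simp [hZ]
    | succ k ih =>
      intro hk
      have e := ht ⟨k, by omega⟩
      simp only at e
      rw [sub_eq_iff_eq_add'.1 e, ih (by omega)]
      simp only [hZ]
      rw [add_assoc]
      congr 1
      have : ∀ l : Fin (g + b - 3),
          (if (l : ℕ) + 2 ≤ k + 1 + 1 then t l • neutralVector (S.div (.planar l)).1 else 0) =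
          (if (l : ℕ) + 2 ≤ k + 1 then t l • neutralVector (S.div (.planar l)).1 else 0) +
          (if ⟨k, by omega⟩ = l then t l • neutralVector (S.div (.planar l)).1 else 0) := by
        intro l
        simp only [Fin.ext_iff]
        rcases lt_trichotomy (l : ℕ) k with h | h | h
        · rw [if_pos (by omega), if_pos (by omega), if_neg (by omega), add_zero]
        · rw [if_pos (by omega), if_neg (by omega), if_pos (by omega), zero_add]
        · rw [if_neg (by omega), if_neg (by omega), if_neg (by omega), add_zero]
      rw [Finset.sum_congr rfl fun l _ => this l, Finset.sum_add_distrib, Finset.sum_ite_eq,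
        if_pos (Finset.mem_univ _)]
  intro i hi hi'
  show S.loop i ∈ S.eqLocus u (S.coboundary (Z i))
  -- The last pair of pants carries two loops: the final one is its third boundary curve, and no
  -- planar jump separates it from its predecessor.
  by_cases hlast : i + 1 = b + g
  · have hZi : Z i = Z (b + g - 3 + 1) := by
      simp only [hZ]
      congr 1
      refine Finset.sum_congr rfl fun l _ => ?_
      have := l.2
      rw [if_pos (by omega), if_pos (by omega)]
    have h := hz (b + g - 3) (by omega)
    rw [hZi, ← hzZ _ (by omega)]
    have e := S.head_pred_last (by omega)
    rw [show b + g - 1 = i by omega] at e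
    rw [← inv_inv (S.loop i), ← e, show i = b + g - 3 + 1 + 1 by omega, head_succ]
    exact Subgroup.inv_mem _ (Subgroup.mul_mem _ h.1 h.2)
  · obtain ⟨k, rfl⟩ := Nat.exists_eq_add_of_le' hi
    rw [← hzZ k (by omega)]
    exact (hz k (by omega)).2

theorem val_coboundary_add_sum {AT : DividingCurve g b → S.Z1}
    (hAT : ∀ c, S.IsAffineTwist c (AT c)) (z : Fin 3 → ℝ) (τ : DividingCurve g b → ℝ)
    (x : SurfaceGen g b) [∀ c : DividingCurve g b, Decidable (c.OnSecondSide x)] :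
    S.val (S.coboundary z + ∑ c, τ c • AT c) (S.elt (FreeGroup.of x)) =
      S.val (S.coboundary (z + ∑ c, if c.OnSecondSide x then
        τ c • neutralVector (S.div c).1 else 0)) (S.elt (FreeGroup.of x)) := by
  have key : ∀ c, S.val (τ c • AT c) (S.elt (FreeGroup.of x)) =
      S.val (S.coboundary (if c.OnSecondSide x then τ c • neutralVector (S.div c).1 else 0))
        (S.elt (FreeGroup.of x)) := fun c => by
    rw [val_smul, S.val_generator_of_isAffineTwist (hAT c), ← val_smul, ← map_smul, smul_ite,
      smul_zero]
  let ev : S.Z1 →ₗ[ℝ] (Fin 3 → ℝ) :=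
    { toFun := fun u => S.val u (S.elt (FreeGroup.of x))
      map_add' := fun _ _ => rfl
      map_smul' := fun _ _ => rfl }
  rw [map_add, map_sum, val_add, val_add]
  congr 1
  show ev _ = ev _
  rw [map_sum, map_sum]
  exact Finset.sum_congr rfl fun c _ => key c

/-- A cocycle whose Margulis invariants on the coordinate curves vanish is, up to a coboundary, a
combination of affine twists. -/
theorem exists_eq_coboundary_add_sum (hb : 0 < b) (hgb : 2 < 2 * g + b)
    (hangle : ∀ (j : Fin g) (θ : ℝ), IsAxisAngle (S.lon j).1 (S.mer j).1 θ → θ ≠ Real.pi / 2)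
    {AT : DividingCurve g b → S.Z1} (hAT : ∀ c, S.IsAffineTwist c (AT c))
    (hu : ∀ x, S.Mar u (S.curve x) = 0) :
    ∃ (z : Fin 3 → ℝ) (τ : DividingCurve g b → ℝ), u = S.coboundary z + ∑ c, τ c • AT c := by
  classical
  by_cases h3 : 3 ≤ g + b
  · obtain ⟨z, t, ht⟩ := S.exists_planar_parameters hb h3 hu
    set Z : ℕ → Fin 3 → ℝ := fun i => z + ∑ k : Fin (g + b - 3),
      if (k : ℕ) + 2 ≤ i then t k • neutralVector (S.div (.planar k)).1 else 0 with hZ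
    have hy : ∀ j : Fin g, ∃ y : Fin 3 → ℝ, S.lon j ∈ S.eqLocus u (S.coboundary y) ∧
        S.mer j ∈ S.eqLocus u (S.coboundary y) := fun j =>
      S.exists_common_handle hb hangle hu j (S.exists_mem_eqLocus_loop h3 hu (by omega))
    choose y hy using hy
    have hs : ∀ j : Fin g, ∃ s : ℝ,
        y j - Z (b + j) = s • neutralVector (S.div (.handle j h3)).1 := fun j => by
      have hl : S.loop (b + j) ∈ S.eqLocus u (S.coboundary (y j)) := by
        rw [loop_handle]
        exact Subgroup.mul_mem _ (Subgroup.mul_mem _ (Subgroup.mul_mem _ (hy j).1 (hy j).2)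
          (Subgroup.inv_mem _ (hy j).1)) (Subgroup.inv_mem _ (hy j).2)
      refine S.eq_smul_neutralVector ?_ ?_
      · intro h
        exact (S.not_commute_lon_mer hb j).2 (by
          rw [show S.lon j * S.mer j * (S.lon j)⁻¹ * (S.mer j)⁻¹ = 1 from h]
          exact Commute.one_right _)
      · rw [div_handle]
        exact S.sub_fixed_of_mem_eqLocus hl (ht _ (by omega) (by omega))
    choose s hs using hs
    let τ : DividingCurve g b → ℝ := fun c => match c with
      | .handle j _ => s j
      | .planar k => t k
    refine ⟨z, τ, S.eq_of_eq_generators hb fun x hx => ?_⟩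
    rw [S.val_coboundary_add_sum hAT, DividingCurve.sum_eq h3]
    have hsum : (z + (∑ j : Fin g, (if (DividingCurve.handle j h3).OnSecondSide x then
          τ (.handle j h3) • neutralVector (S.div (.handle j h3)).1 else 0) +
        ∑ k : Fin (g + b - 3), if (DividingCurve.planar k).OnSecondSide x then
          τ (.planar k) • neutralVector (S.div (.planar k)).1 else 0)) =
        Z x.pos + ∑ j : Fin g, (if x.pos = b + j then
          s j • neutralVector (S.div (.handle j h3)).1 else 0) := by
      simp only [hZ]
      rw [add_comm (∑ j : Fin g, _), add_assoc]
      congr 2 <;> exact Finset.sum_congr rfl fun _ _ =>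
        if_congr Iff.rfl rfl rfl
    -- At a given position, `Z` has collected the planar jumps, and the remaining sum adds the jump
    -- into the handle there, if any.
    rw [hsum]
    have hhandle : ∀ j : Fin g, Z (b + j) + ∑ i : Fin g, (if b + (j : ℕ) = b + i then
        s i • neutralVector (S.div (.handle i h3)).1 else 0) = y j := fun j => by
      simp only [add_right_inj, ← Fin.ext_iff]
      rw [Finset.sum_ite_eq, if_pos (Finset.mem_univ _), ← hs j, add_sub_cancel]
    cases x with
    | bdry i =>
      have e : ∑ j : Fin g, (if (SurfaceGen.bdry i : SurfaceGen g b).pos = b + j then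
          s j • neutralVector (S.div (.handle j h3)).1 else 0) = 0 :=
        Finset.sum_eq_zero fun j _ => if_neg (by simp only [SurfaceGen.pos]; omega)
      rw [e, add_zero, ← loop_bdry]
      refine ht i ?_ (by omega)
      by_contra! h
      exact hx (congrArg SurfaceGen.bdry (Fin.ext (by simp only; omega)))
    | lon j => exact (hy j).1.trans (by rw [← hhandle j]; rfl)
    | mer j => exact (hy j).2.trans (by rw [← hhandle j]; rfl)
  · have hg : g = 1 := by omega
    have hb1 : b = 1 := by omega
    subst hg hb1
    have := DividingCurve.isEmpty (g := 1) (b := 1) (by norm_num)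
    obtain ⟨v, hv⟩ := S.exists_mem_eqLocus_of_Mar_eq_zero (hu (.bdry 0))
    have h1 : S.loop 0 ∈ S.eqLocus u (S.coboundary v) := by
      rw [show S.loop 0 = _ from S.loop_bdry 0]
      exact hv
    have h2 : S.loop (1 + (0 : Fin 1)) ∈ S.eqLocus u (S.coboundary v) := by
      have e := S.head_last
      rw [head_succ, head_one] at e
      rw [show S.loop (1 + (0 : Fin 1)) = _ from eq_inv_of_mul_eq_one_right e]
      exact Subgroup.inv_mem _ h1
    obtain ⟨y, hl, hm⟩ := S.exists_common_handle hb hangle hu 0 ⟨v, h2⟩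
    refine ⟨y, 0, S.eq_of_eq_generators hb fun x hx => ?_⟩
    rw [Fintype.sum_empty, add_zero]
    cases x with
    | bdry i => exact (hx (congrArg SurfaceGen.bdry (Subsingleton.elim _ _))).elim
    | lon j => rw [Subsingleton.elim j 0]; exact hl
    | mer j => rw [Subsingleton.elim j 0]; exact hm

end Kernel

/-! ### Coordinates -/

/-- The Margulis invariants of the coordinate curves. -/
noncomputable def margulis : S.Z1 →ₗ[ℝ] (CoordCurve g b → ℝ) where
  toFun u x := S.Mar u (S.curve x)
  map_add' u v := funext fun x => by
    simp only [Mar, val_add, lorentz_add_left, Pi.add_apply]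
  map_smul' a u := funext fun x => by
    simp only [Mar, val_smul, lorentz_smul_left, Pi.smul_apply, smul_eq_mul, RingHom.id_apply]

/-- The Margulis invariants of the coordinate curves can be prescribed. -/
theorem margulis_surjective (hb : 0 < b) (hgb : 2 < 2 * g + b)
    (hangle : ∀ (j : Fin g) (θ : ℝ), IsAxisAngle (S.lon j).1 (S.mer j).1 θ → θ ≠ Real.pi / 2) :
    Function.Surjective S.margulis := by
  have := S.finite_Z1 hb
  choose AT hAT _ using S.existsUnique_isAffineTwist hb
  have hker : LinearMap.ker S.margulis ≤
      LinearMap.range (S.coboundary.coprod (Fintype.linearCombination ℝ AT)) := by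
    intro u hu
    obtain ⟨z, τ, e⟩ := S.exists_eq_coboundary_add_sum hb hgb hangle hAT
      fun x => congrFun (LinearMap.mem_ker.1 hu) x
    exact ⟨(z, τ), by rw [e]; rfl⟩
  -- The kernel has dimension at most `3 + D`, with `D` the number of dividing curves, so the range
  -- has at least the `|C|` dimensions of the target.
  have h1 := Submodule.finrank_mono hker
  have h2 := LinearMap.finrank_range_le (S.coboundary.coprod (Fintype.linearCombination ℝ AT))
  rw [Module.finrank_prod, Module.finrank_fin_fun, Module.finrank_fintype_fun_eq_card] at h2
  have h3 := S.margulis.finrank_range_add_finrank_ker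
  have h4 := S.finrank_Z1 hb
  have h5 := CoordCurve.card_add_card hb hgb
  have h6 := Submodule.finrank_le (LinearMap.range S.margulis)
  rw [Module.finrank_fintype_fun_eq_card] at h6
  rw [← LinearMap.range_eq_top]
  refine Submodule.eq_top_of_finrank_eq ?_
  rw [Module.finrank_fintype_fun_eq_card]
  omega

/-- The class of the reference cocycle with given Margulis invariants plus a combination of affine
twists. -/
noncomputable def classOfCoordinates (σ : (CoordCurve g b → ℝ) →ₗ[ℝ] S.Z1)
    (AT : DividingCurve g b → S.Z1) :
    (CoordCurve g b → ℝ) × (DividingCurve g b → ℝ) →ₗ[ℝ] S.H1 :=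
  (S.cls ∘ₗ σ).coprod (Fintype.linearCombination ℝ fun c => S.cls (AT c))

theorem classOfCoordinates_apply (σ : (CoordCurve g b → ℝ) →ₗ[ℝ] S.Z1)
    (AT : DividingCurve g b → S.Z1) (m : CoordCurve g b → ℝ) (τ : DividingCurve g b → ℝ) :
    S.classOfCoordinates σ AT (m, τ) = S.cls (σ m) + ∑ c, τ c • S.cls (AT c) := rfl

/-- Subtracting the reference cocycle leaves a cocycle with zero Margulis invariants. -/
theorem exists_cls_eq_classOfCoordinates (hb : 0 < b) (hgb : 2 < 2 * g + b)
    (hangle : ∀ (j : Fin g) (θ : ℝ), IsAxisAngle (S.lon j).1 (S.mer j).1 θ → θ ≠ Real.pi / 2)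
    {AT : DividingCurve g b → S.Z1} (hAT : ∀ c, S.IsAffineTwist c (AT c))
    {σ : (CoordCurve g b → ℝ) →ₗ[ℝ] S.Z1} (hσ : S.IsReference σ) (u : S.Z1) :
    ∃ τ, S.cls u = S.classOfCoordinates σ AT (S.margulis u, τ) := by
  have hu : ∀ x, S.Mar (u - σ (S.margulis u)) (S.curve x) = 0 := fun x => by
    have h : S.margulis (u - σ (S.margulis u)) x = 0 := by
      rw [map_sub, Pi.sub_apply, show S.margulis (σ (S.margulis u)) x = _ from hσ _ x, sub_self]
    exact h
  obtain ⟨z, τ, e⟩ := S.exists_eq_coboundary_add_sum hb hgb hangle hAT hu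
  refine ⟨τ, ?_⟩
  rw [sub_eq_iff_eq_add'.1 e, map_add, map_add, (S.cls_eq_zero_iff _).2 ⟨z, rfl⟩, zero_add,
    map_sum, ← sub_eq_iff_eq_add'.1 e, classOfCoordinates_apply]
  simp only [map_smul]

theorem classOfCoordinates_bijective (hb : 0 < b) (hgb : 2 < 2 * g + b)
    (hangle : ∀ (j : Fin g) (θ : ℝ), IsAxisAngle (S.lon j).1 (S.mer j).1 θ → θ ≠ Real.pi / 2)
    {AT : DividingCurve g b → S.Z1} (hAT : ∀ c, S.IsAffineTwist c (AT c))
    {σ : (CoordCurve g b → ℝ) →ₗ[ℝ] S.Z1} (hσ : S.IsReference σ) :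
    Function.Bijective (S.classOfCoordinates σ AT) := by
  have := S.finite_H1 hb
  have hsurj : Function.Surjective (S.classOfCoordinates σ AT) := fun y => by
    obtain ⟨u, rfl⟩ := S.cls_surjective y
    obtain ⟨τ, hτ⟩ := S.exists_cls_eq_classOfCoordinates hb hgb hangle hAT hσ u
    exact ⟨_, hτ.symm⟩
  refine ⟨(LinearMap.injective_iff_surjective_of_finrank_eq_finrank ?_).2 hsurj, hsurj⟩
  have h1 := S.finrank_H1 hb hgb
  have h2 := CoordCurve.card_add_card hb hgb
  rw [Module.finrank_prod, Module.finrank_fintype_fun_eq_card, Module.finrank_fintype_fun_eq_card]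
  omega

end HyperbolicSurface

/-! ### The coordinate theorem. -/

theorem theorem1 (g b : ℕ) (hb : 0 < b) (hgb : 2 < 2 * g + b) (S : HyperbolicSurface g b)
    (hangle : ∀ (j : Fin g) (θ : ℝ), IsAxisAngle (S.lon j).1 (S.mer j).1 θ → θ ≠ Real.pi / 2) :
    (Module.Finite ℝ S.H1 ∧ Module.finrank ℝ S.H1 + 6 = 6 * g + 3 * b) ∧
    (∀ c : DividingCurve g b, ∃! u : S.Z1, S.IsAffineTwist c u) ∧
    (∃ σ : (CoordCurve g b → ℝ) →ₗ[ℝ] S.Z1, S.IsReference σ) ∧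
    ∀ σ : (CoordCurve g b → ℝ) →ₗ[ℝ] S.Z1, S.IsReference σ →
      ∃ Φ : S.H1 ≃ₗ[ℝ] (CoordCurve g b → ℝ) × (DividingCurve g b → ℝ),
        ∀ (u : S.Z1) (m : CoordCurve g b → ℝ) (τ : DividingCurve g b → ℝ),
          Φ (S.cls u) = (m, τ) ↔
            (∀ x, m x = S.Mar u (S.curve x)) ∧ S.HasTwistParameters σ u τ := by
  refine ⟨⟨S.finite_H1 hb, S.finrank_H1 hb hgb⟩, S.existsUnique_isAffineTwist hb, ?_, ?_⟩
  · obtain ⟨σ, hσ⟩ := S.margulis.exists_rightInverse_of_surjective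
      (LinearMap.range_eq_top.2 (S.margulis_surjective hb hgb hangle))
    exact ⟨σ, fun m x => congrFun (LinearMap.congr_fun hσ m) x⟩
  · intro σ hσ
    choose AT hAT hAT' using S.existsUnique_isAffineTwist hb
    have hbij := S.classOfCoordinates_bijective hb hgb hangle hAT hσ
    refine ⟨(LinearEquiv.ofBijective _ hbij).symm, fun u m τ => ?_⟩
    rw [LinearEquiv.symm_apply_eq, LinearEquiv.ofBijective_apply]
    constructor
    · intro h
      -- The class of `u` also has coordinates whose first part is the Margulis invariants of `u`;
      -- injectivity identifies them with `(m, τ)`.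
      obtain ⟨τ', h'⟩ := S.exists_cls_eq_classOfCoordinates hb hgb hangle hAT hσ u
      obtain ⟨rfl, rfl⟩ := Prod.mk.inj (hbij.1 (h.symm.trans h'))
      exact ⟨fun _ => rfl, AT, hAT, h⟩
    · rintro ⟨hm, AT', hAT'', h⟩
      obtain rfl : AT' = AT := funext fun c => hAT' c _ (hAT'' c)
      obtain rfl : m = fun x => S.Mar u (S.curve x) := funext hm
      exact h
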